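/- Let $B\subset\mathbb{R}^3$ be the unit ball, $\partial B=\mathbb{S}^2$ with surface measure $ds$ and exterior unit normal $\nu(\mathbf x)=\mathbf x$, let $k>0$, and let $G_k(\mathbf z)=-\dfrac{e^{ik|\mathbf z|}}{4\pi|\mathbf z|}$ be the outgoing fundamental solution of $\Delta+k^2$ in $\mathbb{R}^3$. The Neumann–Poincaré operator is $$(\mathcal K_B^k)^*[\psi](\mathbf x)=\mathrm{p.v.}\int_{\partial B}\frac{\partial G_k(\mathbf x-\mathbf y)}{\partial\nu(\mathbf x)}\,\psi(\mathbf y)\,ds_{\mathbf y},\qquad \mathbf x\in\partial B,$$ where $\mathrm{p.v.}$ denotes the limit, as $\varepsilon\to0^+$, of the integrals over $\{\mathbf y\in\partial B:|\mathbf x-\mathbf y|>\varepsilon\}$. For $n\ge 0$ let $P_n$ be the Legendre polynomial of degree $n$, let $j_n$ and $y_n$ be the spherical Bessel and Neumann functions $$j_n(t)=\sum_{l=0}^\infty\frac{(-1)^l\,t^{2l+n}}{2^l\,l!\;1\cdot3\cdots(2n+2l+1)},\qquad y_n(t)=-\frac{(2n)!}{2^n n!}\sum_{l=0}^\infty\frac{(-1)^l\,t^{2l-n-1}}{2^l\,l!\,(-2n+1)(-2n+3)\cdots(-2n+2l-1)},$$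 let $h_n^{(1)}=j_n+iy_n$ be the spherical Hankel function of the first kind, and for integers $m$ with $|m|\le n$ let $Y_n^m$ be the spherical harmonic $$Y_n^m(\theta,\varphi)=\sqrt{\frac{2n+1}{4\pi}\frac{(n-|m|)!}{(n+|m|)!}}\;P_n^{|m|}(\cos\theta)\,e^{im\varphi},\qquad P_n^{m}(t)=(1-t^2)^{m/2}\frac{d^mP_n}{dt^m}(t)\quad(0\le m\le n).$$ Then, for all $k>0$, $n\ge0$ and $|m|\le n$, the principal value defining $(\mathcal K_B^k)^*[Y_n^m](\mathbf x)$ exists at every $\mathbf x\in\partial B$, and $$(\mathcal K_B^k)^*[Y_n^m]=\frac{ik}{2}\bigl(j_n(k)h_n^{(1)}(k)+c_{n,k}\bigr)Y_n^m\quad\text{on }\partial B,$$ where $$c_{n,k}=-\frac12\int_{-1}^1e^{ik\sqrt{2(1-t)}}P_n(t)\,dt.$$ -/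

import Mathlib

open MeasureTheory Set Filter Topology

noncomputable section

namespace HelmholtzNP

/-- Three-dimensional Euclidean space. -/
abbrev E3 : Type := EuclideanSpace ℝ (Fin 3)

/-- The unit sphere, i.e. the boundary of the unit ball `B`. -/
abbrev S2 : Type := Metric.sphere (0 : E3) 1

/-- The surface measure `ds` on the unit sphere. -/
def surface : Measure S2 := (volume : Measure E3).toSphere

/-- The Legendre polynomial of degree `n` (Rodrigues' formula). -/
def legendreP (n : ℕ) : Polynomial ℝ :=
  Polynomial.C (1 / (2 ^ n * (n.factorial : ℝ))) *
    Polynomial.derivative^[n] ((Polynomial.X ^ 2 - 1) ^ n)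

/-- The associated Legendre function `(1 - t²)^(m/2) * (d/dt)^m P_n(t)`. -/
def assocLegendre (n m : ℕ) (t : ℝ) : ℝ :=
  Real.sqrt (1 - t ^ 2) ^ m * (Polynomial.derivative^[m] (legendreP n)).eval t

/-- The spherical harmonic `Y_n^m`, where `-n ≤ m ≤ n`, normalised in `L²` of the unit sphere.
With `x = (sin θ cos φ, sin θ sin φ, cos θ)` one has `cos θ = x₃`, and `φ` is the argument of
`x₁ + i x₂`; at the poles the value chosen for `φ` plays no role. -/
def sphericalHarmonic (n : ℕ) (m : ℤ) (x : S2) : ℂ :=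
  (Real.sqrt ((2 * n + 1) / (4 * Real.pi) *
      (((n - m.natAbs).factorial : ℝ) / ((n + m.natAbs).factorial : ℝ))) : ℂ) *
    (assocLegendre n m.natAbs ((x : E3) 2) : ℂ) *
    Complex.exp (Complex.I * (m : ℂ) *
      (Complex.arg (⟨(x : E3) 0, (x : E3) 1⟩ : ℂ) : ℂ))

/-- The spherical Bessel function
`j_n(t) = ∑ (-1)^l t^(2l+n) / (2^l l! 1·3⋯(2n+2l+1))`. -/
def sphericalJ (n : ℕ) (t : ℝ) : ℝ :=
  ∑' l : ℕ, (-1) ^ l * t ^ (2 * l + n) /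
    (2 ^ l * (l.factorial : ℝ) * (Nat.doubleFactorial (2 * n + 2 * l + 1) : ℝ))

/-- The spherical Neumann function `y_n(t) =
-(2n)!/(2^n n!) ∑ (-1)^l t^(2l-n-1) / (2^l l! (-2n+1)(-2n+3)⋯(-2n+2l-1))`, for `t ≠ 0`. -/
def sphericalY (n : ℕ) (t : ℝ) : ℝ :=
  -(((2 * n).factorial : ℝ) / (2 ^ n * (n.factorial : ℝ))) *
    ∑' l : ℕ, (-1) ^ l * t ^ (2 * (l : ℤ) - (n : ℤ) - 1) /
      (2 ^ l * (l.factorial : ℝ) *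
        ∏ i ∈ Finset.range l, (-2 * (n : ℝ) + 2 * (i : ℝ) + 1))

/-- The spherical Hankel function of the first kind, `h_n^{(1)} = j_n + i y_n`. -/
def sphericalH1 (n : ℕ) (t : ℝ) : ℂ :=
  (sphericalJ n t : ℂ) + Complex.I * (sphericalY n t : ℂ)

/-- The outgoing fundamental solution `G_k(z) = -e^{ik|z|} / (4π|z|)` of `Δ + k²` in `ℝ³`. -/
def greenFn (k : ℝ) (z : E3) : ℂ :=
  -(Complex.exp (Complex.I * (k : ℂ) * (‖z‖ : ℂ)) / (4 * (Real.pi : ℂ) * (‖z‖ : ℂ)))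

/-- The normal derivative `∂G_k(x - y)/∂ν(x)` at `x` on the unit sphere, the derivative being
taken in the variable `x` in the direction of the exterior unit normal `ν(x) = x`. -/
def normalDerivGreen (k : ℝ) (x y : S2) : ℂ :=
  fderiv ℝ (fun z : E3 => greenFn k (z - (y : E3))) (x : E3) (x : E3)

/-- The integral of `f` over the part of the unit sphere at distance more than `ε` from `x`. -/
def truncatedIntegral (f : S2 → ℂ) (x : S2) (ε : ℝ) : ℂ :=
  ∫ y in {y : S2 | ε < dist x y}, f y ∂surface

/-- The principal value integral of `f` over the unit sphere, with singular point `x`, exists: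
the truncated integrals converge absolutely and have a limit as `ε → 0+`. -/
def PVExists (f : S2 → ℂ) (x : S2) : Prop :=
  (∀ ε : ℝ, 0 < ε → IntegrableOn f {y : S2 | ε < dist x y} surface) ∧
    ∃ L : ℂ, Tendsto (truncatedIntegral f x) (𝓝[>] 0) (𝓝 L)

/-- The Cauchy principal value of the integral of `f` over the unit sphere, with singular point
`x` (meaningful where `PVExists f x`). -/
def pvIntegral (f : S2 → ℂ) (x : S2) : ℂ :=
  limUnder (𝓝[>] (0 : ℝ)) (truncatedIntegral f x)

/-- The Neumann–Poincaré operator of the unit ball,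
`(K_B^k)^*[ψ](x) = p.v. ∫_{∂B} ∂G_k(x - y)/∂ν(x) ψ(y) ds_y`. -/
def neumannPoincare (k : ℝ) (ψ : S2 → ℂ) (x : S2) : ℂ :=
  pvIntegral (fun y => normalDerivGreen k x y * ψ y) x

/-- `c_{n,k} = -(1/2) ∫_{-1}^1 e^{ik√(2(1-t))} P_n(t) dt`. -/
def cCoeff (n : ℕ) (k : ℝ) : ℂ :=
  -(1 / 2) * ∫ t in (-1 : ℝ)..1,
    Complex.exp (Complex.I * (k : ℂ) * (Real.sqrt (2 * (1 - t)) : ℂ)) *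
      (((legendreP n).eval t : ℝ) : ℂ)

end HelmholtzNP

end

noncomputable section

namespace HelmholtzNP

/-! For distinct unit vectors with `r = |x - y|` and `t = x · y` one has `r² = 2(1 - t)` and `(x -
y) · x = r²/2`, so the normal derivative of `G_k` is `(e^{ikr}/r - ik e^{ikr})/(8π)`
(`normalDerivGreen_eq`). This kernel depends on `t` alone and its singularity is integrable, so the
principal value is an ordinary integral (`tendsto_truncatedIntegral`). The Funk–Hecke formula
(`funkHecke_sphericalHarmonic`) then makes `Y_n^m` an eigenfunction with eigenvalue `2π ∫ kernel(t)
P_n(t) dt`.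

The term `-ik e^{ikr}` yields `c_{n,k}` by definition. In the other term, the substitution `t = 1 -
s²/2` cancels the singularity, and what remains is `∫₀² e^{iks} P_n(1 - s²/2) ds = 2ik j_n(k)
h_n(k)` (`integral_exp_mul_legendreP`). Both sides are compared as power series in `k`. On the left,
the moments of `P_n` have a closed product form (`sum_shiftedCoeff_div`). On the right, a
Vandermonde convolution gives the Cauchy products of the Bessel series (`hasSum_product`). Even
powers match `j_n y_n` and odd powers match `j_n²`.

Funk–Hecke is first proved for `(ζ · y)^n` with `ζ` isotropic: after moving `x` to the pole by an
isometry, Laplace's integral over each circle of latitude produces `P_n(t)`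
(`integral_complexForm_pow_spherePoint`). For a suitable family `ζ_w`, every `Y_n^m` is, up to a
constant, a coefficient of `(ζ_w · y)^n` as a polynomial in `w`, and the formula passes to
coefficients. -/

/-! ### Shifted Legendre polynomials and their partial fraction sums -/

open Polynomial in
theorem iterate_derivative_comp_one_sub_two_mul_X (p : ℝ[X]) (n : ℕ) :
    derivative^[n] (p.comp (1 - 2 * X)) = (-2) ^ n * (derivative^[n] p).comp (1 - 2 * X) := by
  induction n with
  | zero => simp
  | succ n ih =>
    have h2 : derivative ((-2 : ℝ[X]) ^ n) = 0 := by
      rw [show (-2 : ℝ[X]) ^ n = C ((-2) ^ n) by simp [← C_ofNat], derivative_C]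
    have h3 : derivative (2 : ℝ[X]) = 0 := derivative_ofNat 2
    rw [Function.iterate_succ_apply', ih, Function.iterate_succ_apply', derivative_mul, h2,
      derivative_comp]
    simp [h3]
    ring

/-- The coefficients of the shifted Legendre polynomial `P_n (1 - 2u)`. -/
def shiftedCoeff (n k : ℕ) : ℝ := (-1) ^ k * n.choose k * (n + k).choose n

open Polynomial in
theorem legendreP_comp (n : ℕ) :
    (legendreP n).comp (1 - 2 * X) = (shiftedLegendre n).map (Int.castRingHom ℝ) := by
  have h1 := congrArg (Polynomial.map (Int.castRingHom ℝ)) (factorial_mul_shiftedLegendre_eq n)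
  rw [← iterate_derivative_map] at h1
  simp only [Polynomial.map_mul, Polynomial.map_pow, map_X, Polynomial.map_sub, Polynomial.map_one,
    Polynomial.map_natCast] at h1
  have h2 := iterate_derivative_comp_one_sub_two_mul_X ((X ^ 2 - 1) ^ n) n
  -- This matches the two Rodrigues formulas: `(1 - 2X)² - 1 = -4 X (1 - X)`, and the chain rule
  -- accounts for a factor `(-2)^n`.
  have h3 : ((X ^ 2 - 1 : ℝ[X]) ^ n).comp (1 - 2 * X) = C ((-4) ^ n) * (X ^ n * (1 - X) ^ n) := by
    simp only [pow_comp, sub_comp, X_comp, one_comp, map_pow, map_neg]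
    rw [← mul_pow, ← mul_pow]
    congr 1
    simp only [map_ofNat]
    ring
  rw [h3, iterate_derivative_C_mul, ← h1] at h2
  have h4 : (C ((-2) ^ n) : ℝ[X]) * ((legendreP n).comp (1 - 2 * X)) =
      C ((-2) ^ n) * (shiftedLegendre n).map (Int.castRingHom ℝ) := by
    rw [legendreP, mul_comp, C_comp]
    have h5 : C ((-2 : ℝ) ^ n) = (-2 : ℝ[X]) ^ n := by simp [← C_ofNat]
    rw [mul_left_comm, h5, ← h2, ← mul_assoc, ← mul_assoc, ← C_mul, ← C_eq_natCast, ← C_mul, ← h5]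
    congr 2
    have : (n.factorial : ℝ) ≠ 0 := by positivity
    field_simp
    rw [← mul_pow]; norm_num
  refine mul_left_cancel₀ ?_ h4
  simp

open Polynomial in
theorem legendreP_eval_one_sub_two_mul (n : ℕ) (u : ℝ) :
    (legendreP n).eval (1 - 2 * u) = ∑ k ∈ Finset.range (n + 1), shiftedCoeff n k * u ^ k := by
  have h := congrArg (Polynomial.eval u) (legendreP_comp n)
  rw [eval_comp] at h
  simp only [eval_sub, eval_one, eval_mul, eval_ofNat, eval_X] at h
  rw [h, shiftedLegendre]
  simp [Polynomial.map_sum, eval_finsetSum, shiftedCoeff]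

/-- The sum is the value of `P_n(1 - 2u)` at `u = 1`, obtained from the symmetry `u ↦ 1 - u` and the
constant coefficient. -/
theorem sum_shiftedCoeff (n : ℕ) : ∑ k ∈ Finset.range (n + 1), shiftedCoeff n k = (-1) ^ n := by
  have h := Polynomial.shiftedLegendre_eval_symm n (1 : ℝ)
  rw [sub_self, ← Polynomial.coeff_zero_eq_aeval_zero', Polynomial.coeff_shiftedLegendre] at h
  simpa [Polynomial.shiftedLegendre, shiftedCoeff] using h

theorem shiftedCoeff_succ (n k : ℕ) :
    shiftedCoeff (n + 1) k * (n + 1 - k) = shiftedCoeff n k * (n + 1 + k) := by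
  unfold shiftedCoeff
  have h1 : ((n + 1).choose k : ℝ) * (n + 1 - k) = (n + 1) * n.choose k := by
    rcases le_or_gt k (n + 1) with h | h
    · have := Nat.choose_mul_succ_eq n k
      have h' : ((n + 1 - k : ℕ) : ℝ) = n + 1 - k := by push_cast [h]; ring
      rw [← h']
      exact_mod_cast (by rw [← this]; ring)
    · rw [Nat.choose_eq_zero_of_lt h, Nat.choose_eq_zero_of_lt (by omega)]; simp
  have h2 : ((n + 1 + k).choose (n + 1) : ℝ) * (n + 1) = (n + 1 + k) * (n + k).choose n := by
    have := Nat.add_one_mul_choose_eq (n + k) n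
    rw [show n + 1 + k = n + k + 1 by ring]
    have h : (((n + k + 1) * (n + k).choose n : ℕ) : ℝ) = ((n + k + 1).choose (n + 1) * (n + 1) : ℕ) := by
      exact_mod_cast this
    push_cast at h
    linarith
  have h0 : (n + 1 : ℝ) ≠ 0 := by positivity
  apply mul_right_cancel₀ h0
  linear_combination (-1) ^ k * ((n + 1 + k).choose (n + 1) : ℝ) * (n + 1) * h1
    + (-1) ^ k * (n + 1) * n.choose k * h2

/-- For `b > 0` this is the moment `∫₀¹ u^(b-1) P_n(1 - 2u) du`. The induction rests on `(b+n+1)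
c_{n+1,k} - (n+1-b) c_{n,k} = (b+k)(c_{n+1,k} + c_{n,k})`: dividing by `b + k` and summing over `k`
leaves a right-hand side independent of `b`. -/
theorem sum_shiftedCoeff_div (n : ℕ) (b : ℝ) (hb : 0 < b) :
    ∑ k ∈ Finset.range (n + 1), shiftedCoeff n k / (b + k) =
      (∏ j ∈ Finset.range n, (j + 1 - b)) / ∏ j ∈ Finset.range (n + 1), (b + j) := by
  induction n with
  | zero => simp [shiftedCoeff]
  | succ n ih =>
    have key : (b + n + 1) * ∑ k ∈ Finset.range (n + 1 + 1), shiftedCoeff (n + 1) k / (b + k) =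
        (n + 1 - b) * ∑ k ∈ Finset.range (n + 1), shiftedCoeff n k / (b + k) := by
      have h0 : ∑ k ∈ Finset.range (n + 1 + 1), shiftedCoeff n k / (b + k) =
          ∑ k ∈ Finset.range (n + 1), shiftedCoeff n k / (b + k) := by
        rw [Finset.sum_range_succ]; simp [shiftedCoeff]
      have h1 : ∑ k ∈ Finset.range (n + 1 + 1), shiftedCoeff n k = (-1) ^ n := by
        rw [Finset.sum_range_succ, sum_shiftedCoeff]; simp [shiftedCoeff]
      have h2 := sum_shiftedCoeff (n + 1)
      rw [← h0, Finset.mul_sum, Finset.mul_sum, ← sub_eq_zero, ← Finset.sum_sub_distrib]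
      -- The two sums are `(-1)^(n+1)` and `(-1)^n`.
      have h3 : ∑ k ∈ Finset.range (n + 1 + 1), (shiftedCoeff (n + 1) k + shiftedCoeff n k) = 0 := by
        rw [Finset.sum_add_distrib, h1, h2]; ring
      rw [← h3]
      refine Finset.sum_congr rfl fun k _ => ?_
      have : b + k ≠ 0 := by positivity
      field_simp
      linear_combination shiftedCoeff_succ n k
    rw [ih] at key
    rw [Finset.prod_range_succ, Finset.prod_range_succ _ (n + 1)]
    have : b + n + 1 ≠ 0 := by positivity
    apply mul_left_cancel₀ this
    rw [key]
    have : ∏ j ∈ Finset.range (n + 1), (b + j) ≠ 0 := Finset.prod_ne_zero_iff.2 fun j _ => by positivity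
    push_cast
    have : b + (n + 1) ≠ 0 := by positivity
    field_simp
    ring

/-! ### Factorial products of step two and the Vandermonde convolution -/

/-- The falling product `x (x - 2) ⋯ (x - 2 (n - 1))`. -/
def fallTwo (x : ℝ) (n : ℕ) : ℝ := ∏ i ∈ Finset.range n, (x - 2 * i)

theorem fallTwo_succ (x : ℝ) (n : ℕ) : fallTwo x (n + 1) = fallTwo x n * (x - 2 * n) := by
  rw [fallTwo, Finset.prod_range_succ, fallTwo]

/-- Chu–Vandermonde with step two: `fallTwo x n / n!` is the coefficient of `z^n` in `(1 +
2z)^(x/2)`. -/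
theorem fallTwo_add (x y : ℝ) (n : ℕ) :
    ∑ p ∈ Finset.HasAntidiagonal.antidiagonal n, (n.choose p.1 : ℝ) * (fallTwo x p.1 * fallTwo y p.2) =
      fallTwo (x + y) n := by
  induction n with
  | zero => simp [fallTwo]
  | succ n ih =>
    rw [Finset.sum_antidiagonal_choose_succ_mul (fun i j => fallTwo x i * fallTwo y j),
      ← Finset.sum_add_distrib, fallTwo_succ, ← ih, Finset.sum_mul]
    refine Finset.sum_congr rfl fun p hp => ?_
    have hp' := Finset.HasAntidiagonal.mem_antidiagonal.1 hp
    have h1 : n.choose p.2 = n.choose p.1 := (Nat.choose_symm_of_eq_add (by omega)).symm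
    have h2 : (n : ℝ) = p.1 + p.2 := by exact_mod_cast hp'.symm
    rw [h1, fallTwo_succ, fallTwo_succ, h2]
    ring

/-- The rising product `α (α + 2) ⋯ (α + 2 (n - 1))`. -/
def riseTwo (α : ℝ) (n : ℕ) : ℝ := ∏ i ∈ Finset.range n, (α + 2 * i)

theorem riseTwo_succ (x : ℝ) (n : ℕ) : riseTwo x (n + 1) = riseTwo x n * (x + 2 * n) := by
  rw [riseTwo, Finset.prod_range_succ, riseTwo]

/-- The last `m` factors of the rising product, read backwards, form a falling product. -/
theorem riseTwo_add (α : ℝ) (l m : ℕ) :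
    riseTwo α (l + m) = riseTwo α l * fallTwo (α + 2 * (l + m) - 2) m := by
  rw [riseTwo, Finset.prod_range_add, riseTwo, fallTwo]
  congr 1
  rw [← Finset.prod_range_reflect]
  refine Finset.prod_congr rfl fun i hi => ?_
  have hi' := Finset.mem_range.1 hi
  have : ((m - 1 - i : ℕ) : ℝ) = m - 1 - i := by
    rw [Nat.sub_sub, Nat.cast_sub (by omega)]; push_cast; ring
  push_cast
  rw [this]
  ring

/-- The coefficient in the product of two Bessel-type series. Multiplied by `N! · riseTwo α N ·
riseTwo β N`, each summand becomes a binomial coefficient times two falling products whose bases do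
not depend on the summation index, so `fallTwo_add` applies. -/
theorem sum_antidiagonal_riseTwo (α β : ℝ) (hα : ∀ n, riseTwo α n ≠ 0) (hβ : ∀ n, riseTwo β n ≠ 0)
    (N : ℕ) :
    ∑ p ∈ Finset.HasAntidiagonal.antidiagonal N,
      (1 / ((p.1.factorial : ℝ) * riseTwo α p.1)) * (1 / ((p.2.factorial : ℝ) * riseTwo β p.2)) =
    fallTwo (α + β + 4 * N - 4) N / (N.factorial * riseTwo α N * riseTwo β N) := by
  have h := fallTwo_add (β + 2 * N - 2) (α + 2 * N - 2) N
  rw [show β + 2 * N - 2 + (α + 2 * N - 2) = α + β + 4 * (N : ℝ) - 4 by ring] at h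
  rw [← h, Finset.sum_div]
  refine Finset.sum_congr rfl fun p hp => ?_
  obtain ⟨l, m⟩ := p
  obtain rfl := Finset.HasAntidiagonal.mem_antidiagonal.1 hp
  have h1 := riseTwo_add α l m
  have h2 := riseTwo_add β m l
  have h3 : ((l + m).choose l : ℝ) * l.factorial * m.factorial = (l + m).factorial := by
    rw [Nat.choose_symm_add]; exact_mod_cast Nat.add_choose_mul_factorial_mul_factorial l m
  have a1 := hα l
  have a2 := hβ m
  have a3 := hα (l + m)
  have a4 := hβ (l + m)
  have e1 : fallTwo (α + 2 * ((l + m : ℕ) : ℝ) - 2) m = riseTwo α (l + m) / riseTwo α l := by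
    rw [h1]; push_cast; field_simp
  have e2 : fallTwo (β + 2 * ((l + m : ℕ) : ℝ) - 2) l = riseTwo β (l + m) / riseTwo β m := by
    rw [add_comm l m, h2]; push_cast; field_simp
  simp only
  rw [e1, e2, ← h3]
  have h4 : ((l + m).choose l : ℝ) ≠ 0 := by
    exact_mod_cast (Nat.choose_pos (Nat.le_add_right l m)).ne'
  field_simp

theorem fallTwo_two_mul (a N : ℕ) :
    fallTwo (2 * ((a + N : ℕ) : ℝ)) N * a.factorial = 2 ^ N * (a + N).factorial := by
  induction N generalizing a with
  | zero => simp [fallTwo]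
  | succ N ih =>
    have := ih (a + 1)
    rw [fallTwo_succ, show a + (N + 1) = a + 1 + N by ring]
    have h : ((a + 1).factorial : ℝ) = (a + 1) * a.factorial := by
      rw [Nat.factorial_succ]; push_cast; ring
    rw [h] at this
    rw [pow_succ]
    push_cast at this ⊢
    linear_combination 2 * this

/-! ### Closed forms of the moments at half-integers and integers -/

/-- The value of `∑ k, shiftedCoeff n k / (b + k)`. -/
def cauchySum (n : ℕ) (b : ℝ) : ℝ := ∑ k ∈ Finset.range (n + 1), shiftedCoeff n k / (b + k)

/-- Shifting `b` by one shifts both products of `sum_shiftedCoeff_div` by one index, so only their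
end factors change. This drives the induction over half-integers. -/
theorem cauchySum_add_one (n : ℕ) (b : ℝ) (hb : 0 < b) :
    cauchySum n (b + 1) * ((n - b) * (b + n + 1)) = -b ^ 2 * cauchySum n b := by
  rw [cauchySum, cauchySum, sum_shiftedCoeff_div n b hb, sum_shiftedCoeff_div n (b + 1) (by linarith)]
  have h1 : (∏ j ∈ Finset.range n, ((j : ℝ) + 1 - (b + 1))) * (n - b) =
      -b * ∏ j ∈ Finset.range n, ((j : ℝ) + 1 - b) := by
    have := Finset.prod_range_succ (fun j : ℕ => (j : ℝ) + 1 - (b + 1)) n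
    rw [Finset.prod_range_succ'] at this
    calc _ = (∏ j ∈ Finset.range n, ((j : ℝ) + 1 - (b + 1))) * (n + 1 - (b + 1)) := by ring
      _ = _ := by
        rw [← this]
        push_cast
        rw [Finset.prod_congr rfl (fun (j : ℕ) _ => show (j : ℝ) + 1 + 1 - (b + 1) = j + 1 - b by ring)]
        ring
  have h2 : (∏ j ∈ Finset.range (n + 1), (b + j)) * (b + n + 1) =
      b * ∏ j ∈ Finset.range (n + 1), (b + 1 + j) := by
    have := Finset.prod_range_succ (fun j : ℕ => b + (j : ℝ)) (n + 1)
    rw [Finset.prod_range_succ'] at this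
    calc _ = (∏ j ∈ Finset.range (n + 1), (b + j)) * (b + (n + 1 : ℕ)) := by push_cast; ring
      _ = _ := by
        rw [← this]
        push_cast
        rw [Finset.prod_congr rfl (fun (j : ℕ) _ => show b + ((j : ℝ) + 1) = b + 1 + j by ring)]
        ring
  have p1 : ∏ j ∈ Finset.range (n + 1), (b + j) ≠ 0 :=
    Finset.prod_ne_zero_iff.2 fun j _ => by positivity
  have p2 : ∏ j ∈ Finset.range (n + 1), (b + 1 + j) ≠ 0 :=
    Finset.prod_ne_zero_iff.2 fun j _ => by positivity
  generalize (∏ j ∈ Finset.range n, ((j : ℝ) + 1 - (b + 1))) = A at *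
  generalize (∏ j ∈ Finset.range n, ((j : ℝ) + 1 - b)) = B at *
  generalize (∏ j ∈ Finset.range (n + 1), (b + j)) = C at *
  generalize (∏ j ∈ Finset.range (n + 1), (b + 1 + j)) = D at *
  field_simp
  linear_combination C * (b + n + 1) * h1 - b * B * h2

theorem riseTwo_pos (α : ℝ) (hα : 0 < α) (n : ℕ) : 0 < riseTwo α n :=
  Finset.prod_pos fun i _ => by positivity

/-- Each factor is an odd integer, hence nonzero. The bound serves both for division and for
convergence of the series of `y_n`. -/
theorem one_le_abs_riseTwo_odd (n m : ℕ) : 1 ≤ |riseTwo (1 - 2 * n) m| := by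
  rw [riseTwo, Finset.abs_prod]
  refine Finset.prod_induction _ (fun x : ℝ => 1 ≤ x) (fun _ _ ha hb => one_le_mul_of_one_le_of_one_le ha hb)
    le_rfl fun i _ => ?_
  have h : (1 : ℤ) ≤ |1 - 2 * (n : ℤ) + 2 * (i : ℤ)| := Int.one_le_abs (by omega)
  exact_mod_cast h

theorem doubleFactorial_riseTwo (n l : ℕ) :
    (Nat.doubleFactorial (2 * n + 2 * l + 1) : ℝ) =
      Nat.doubleFactorial (2 * n + 1) * riseTwo (2 * n + 3) l := by
  induction l with
  | zero => simp [riseTwo]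
  | succ l ih =>
    rw [show 2 * n + 2 * (l + 1) + 1 = (2 * n + 2 * l + 1) + 2 by ring, Nat.doubleFactorial_add_two,
      riseTwo_succ, Nat.cast_mul, ih]
    push_cast
    ring

/-- The moment of `s^(2N)`, written with the two rising products that occur in the series of `j_n`
and `y_n`. -/
theorem cauchySum_even (n N : ℕ) :
    4 ^ N * cauchySum n (N + 1 / 2) * ((2 * n + 1) * N.factorial ^ 2 *
      riseTwo (2 * n + 3) N * riseTwo (1 - 2 * n) N) = 2 * (2 * N).factorial ^ 2 := by
  induction N with
  | zero =>
    rw [cauchySum, sum_shiftedCoeff_div _ _ (by norm_num), Finset.prod_range_succ]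
    -- At `b = 1/2` the numerator equals the first `n` factors of the denominator; only `1/(n +
    -- 1/2)` survives.
    have h : ∏ j ∈ Finset.range n, ((j : ℝ) + 1 - ((0 : ℕ) + 1 / 2)) =
        ∏ j ∈ Finset.range n, (((0 : ℕ) : ℝ) + 1 / 2 + j) :=
      Finset.prod_congr rfl fun j _ => by push_cast; ring
    have h' : ∏ j ∈ Finset.range n, (((0 : ℕ) : ℝ) + 1 / 2 + j) ≠ 0 :=
      Finset.prod_ne_zero_iff.2 fun j _ => by positivity
    rw [h]
    have : ((0 : ℕ) : ℝ) + 1 / 2 + n ≠ 0 := by positivity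
    simp only [riseTwo, Finset.range_zero, Finset.prod_empty, pow_zero, mul_zero,
      Nat.factorial_zero]
    field_simp
    push_cast
    ring
  | succ N ih =>
    have h := cauchySum_add_one n (N + 1 / 2) (by positivity)
    rw [riseTwo_succ, riseTwo_succ, show 2 * (N + 1) = 2 * N + 1 + 1 by ring,
      Nat.factorial_succ (2 * N + 1), Nat.factorial_succ (2 * N), Nat.factorial_succ N]
    push_cast
    rw [show (N : ℝ) + 1 + 1 / 2 = N + 1 / 2 + 1 by ring]
    generalize cauchySum n ((N : ℝ) + 1 / 2 + 1) = A at *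
    generalize cauchySum n ((N : ℝ) + 1 / 2) = B at *
    linear_combination (-16) * 4 ^ N * (2 * n + 1) * N.factorial ^ 2 * (N + 1) ^ 2 *
      riseTwo (2 * n + 3) N * riseTwo (1 - 2 * n) N * h +
      4 * (N + 1) ^ 2 * (2 * N + 1) ^ 2 * ih

theorem prod_range_sub_mul_factorial (n N : ℕ) :
    (∏ j ∈ Finset.range n, ((j : ℝ) - (n + N : ℕ))) * N.factorial =
      (-1) ^ n * (n + N).factorial := by
  induction n generalizing N with
  | zero => simp
  | succ n ih =>
    have := ih (N + 1)
    rw [Finset.prod_range_succ, show n + 1 + N = n + (N + 1) by ring]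
    rw [Nat.factorial_succ] at this
    push_cast at this ⊢
    linear_combination (-1) * this

theorem prod_range_add_mul_factorial (n q : ℕ) :
    (∏ j ∈ Finset.range (n + 1), ((q : ℝ) + 1 + j)) * q.factorial = (q + n + 1).factorial := by
  induction n with
  | zero => simp [Nat.factorial_succ]
  | succ n ih =>
    rw [Finset.prod_range_succ, show q + (n + 1) + 1 = (q + n + 1) + 1 by ring, Nat.factorial_succ]
    push_cast
    rw [← ih]
    ring

theorem cauchySum_odd (n N : ℕ) :
    cauchySum n ((n + N : ℕ) + 1) * (N.factorial * (2 * n + N + 1).factorial) =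
      (-1) ^ n * (n + N).factorial ^ 2 := by
  rw [cauchySum, sum_shiftedCoeff_div _ _ (by positivity)]
  have h1 := prod_range_sub_mul_factorial n N
  have h2 := prod_range_add_mul_factorial n (n + N)
  have h3 : ∏ j ∈ Finset.range n, ((j : ℝ) + 1 - ((n + N : ℕ) + 1)) =
      ∏ j ∈ Finset.range n, ((j : ℝ) - (n + N : ℕ)) :=
    Finset.prod_congr rfl fun j _ => by ring
  rw [show n + N + n + 1 = 2 * n + N + 1 by ring] at h2
  rw [h3]
  have p1 : ∏ j ∈ Finset.range (n + 1), (((n + N : ℕ) : ℝ) + 1 + j) ≠ 0 :=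
    Finset.prod_ne_zero_iff.2 fun j _ => by positivity
  rw [← h2]
  field_simp
  linear_combination h1

/-- Orthogonality of `P_n` to polynomials of lower degree; here the numerator contains the factor
with `j = q`. -/
theorem cauchySum_odd_of_lt (n q : ℕ) (h : q < n) : cauchySum n (q + 1) = 0 := by
  rw [cauchySum, sum_shiftedCoeff_div _ _ (by positivity),
    Finset.prod_eq_zero (Finset.mem_range.2 h) (by ring), zero_div]

theorem doubleFactorial_odd_mul (q : ℕ) :
    (Nat.doubleFactorial (2 * q + 1) : ℝ) * (2 ^ q * q.factorial) = (2 * q + 1).factorial := by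
  rw [Nat.factorial_eq_mul_doubleFactorial, Nat.doubleFactorial_two_mul]
  push_cast
  ring

/-! ### The integral of `e^{iks} P_n(1 - s²/2)` and products of spherical Bessel functions -/

theorem integral_pow_mul_legendreP (n p : ℕ) :
    ∫ s in (0 : ℝ)..2, s ^ p * (legendreP n).eval (1 - s ^ 2 / 2) =
      2 ^ p * cauchySum n ((p + 1) / 2) := by
  have h (s : ℝ) : s ^ p * (legendreP n).eval (1 - s ^ 2 / 2) =
      ∑ k ∈ Finset.range (n + 1), shiftedCoeff n k / 4 ^ k * s ^ (p + 2 * k) := by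
    rw [show 1 - s ^ 2 / 2 = 1 - 2 * (s ^ 2 / 4) by ring, legendreP_eval_one_sub_two_mul,
      Finset.mul_sum]
    refine Finset.sum_congr rfl fun k _ => ?_
    rw [pow_add, pow_mul, div_pow]
    ring
  simp_rw [h]
  rw [intervalIntegral.integral_finsetSum
    (fun k _ => (by fun_prop : Continuous _).intervalIntegrable _ _), cauchySum, Finset.mul_sum]
  refine Finset.sum_congr rfl fun k _ => ?_
  rw [intervalIntegral.integral_const_mul, integral_pow]
  have h1 : ((p : ℝ) + 1) / 2 + k ≠ 0 := by positivity
  have h2 : ((p + 2 * k : ℕ) : ℝ) + 1 ≠ 0 := by positivity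
  have h3 : (4 : ℝ) ^ k = 2 ^ (2 * k) := by rw [pow_mul]; norm_num
  rw [h3, zero_pow (by omega)]
  field_simp
  push_cast
  ring

theorem hasSum_integral_exp_mul_legendreP (n : ℕ) (k : ℝ) :
    HasSum (fun p : ℕ => (Complex.I * k) ^ p / p.factorial *
        ((2 ^ p * cauchySum n ((p + 1) / 2) : ℝ) : ℂ))
      (∫ s in (0 : ℝ)..2, Complex.exp (Complex.I * k * s) *
        (((legendreP n).eval (1 - s ^ 2 / 2) : ℝ) : ℂ)) := by
  obtain ⟨C, hC⟩ := (isCompact_Icc (a := (0 : ℝ)) (b := 2)).exists_bound_of_continuousOn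
    (f := fun s : ℝ => (legendreP n).eval (1 - s ^ 2 / 2)) (by fun_prop)
  have hsum : Summable fun p : ℕ => (|k| * 2) ^ p / p.factorial * C :=
    (Real.summable_pow_div_factorial _).mul_right C
  have := intervalIntegral.hasSum_integral_of_dominated_convergence (μ := volume) (a := 0) (b := 2)
    (F := fun (p : ℕ) (s : ℝ) => (Complex.I * k * s) ^ p / p.factorial *
      (((legendreP n).eval (1 - s ^ 2 / 2) : ℝ) : ℂ))
    (f := fun s : ℝ => Complex.exp (Complex.I * k * s) *
        (((legendreP n).eval (1 - s ^ 2 / 2) : ℝ) : ℂ))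
    (fun p _ => (|k| * 2) ^ p / p.factorial * C)
    (fun p => (by fun_prop : Continuous _).aestronglyMeasurable)
    (fun p => ae_of_all _ fun s hs => ?_) (ae_of_all _ fun s hs => hsum)
    intervalIntegrable_const (ae_of_all _ fun s hs => ?_)
  · convert! this using 2 with p
    rw [← integral_pow_mul_legendreP, ← intervalIntegral.integral_ofReal,
      ← intervalIntegral.integral_const_mul]
    refine intervalIntegral.integral_congr fun s _ => ?_
    push_cast
    ring
  · rw [uIoc_of_le (by norm_num)] at hs
    have h1 := hC s ⟨hs.1.le, hs.2⟩
    rw [norm_mul, Complex.norm_real, norm_div, norm_pow, norm_mul, norm_mul, Complex.norm_I,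
      Complex.norm_real, Complex.norm_real, Complex.norm_natCast, one_mul]
    have h2 : ‖s‖ ≤ 2 := by rw [Real.norm_of_nonneg hs.1.le]; exact hs.2
    rw [Real.norm_eq_abs k]
    gcongr
  · refine HasSum.mul_right _ ?_
    rw [Complex.exp_eq_exp_ℂ]
    exact NormedSpace.expSeries_div_hasSum_exp _

theorem summable_norm_of_one_le (x : ℝ) (d : ℕ → ℝ) (hd : ∀ l, 1 ≤ |d l|) :
    Summable fun l : ℕ => ‖x ^ l * (1 / ((l.factorial : ℝ) * d l))‖ := by
  refine Summable.of_nonneg_of_le (fun _ => norm_nonneg _) (fun l => ?_)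
    (Real.summable_pow_div_factorial |x|)
  rw [norm_mul, norm_div, norm_mul, norm_pow, norm_one, Real.norm_eq_abs, Real.norm_eq_abs (d l),
    mul_one_div, Real.norm_of_nonneg (by positivity)]
  have := hd l
  gcongr
  exact le_mul_of_one_le_right (by positivity) this

theorem hasSum_product (x : ℝ) (α β : ℝ) (hα : ∀ n, 1 ≤ |riseTwo α n|)
    (hβ : ∀ n, 1 ≤ |riseTwo β n|) :
    HasSum (fun N : ℕ => x ^ N * (fallTwo (α + β + 4 * N - 4) N /
        (N.factorial * riseTwo α N * riseTwo β N)))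
      ((∑' l : ℕ, x ^ l * (1 / ((l.factorial : ℝ) * riseTwo α l))) *
        ∑' l : ℕ, x ^ l * (1 / ((l.factorial : ℝ) * riseTwo β l))) := by
  have h1 := summable_norm_of_one_le x (riseTwo α) hα
  have h2 := summable_norm_of_one_le x (riseTwo β) hβ
  have h3 := (summable_norm_sum_mul_antidiagonal_of_summable_norm h1 h2).of_norm.hasSum
  rw [← tsum_mul_tsum_eq_tsum_sum_antidiagonal_of_summable_norm h1 h2] at h3
  convert! h3 using 2 with N
  rw [← sum_antidiagonal_riseTwo α β (fun n h => by simpa [h] using (hα n).trans_lt' zero_lt_one)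
    (fun n h => by simpa [h] using (hβ n).trans_lt' zero_lt_one), Finset.mul_sum]
  refine Finset.sum_congr rfl fun p hp => ?_
  rw [← Finset.HasAntidiagonal.mem_antidiagonal.1 hp, pow_add]
  ring

theorem sphericalJ_eq (n : ℕ) (t : ℝ) :
    sphericalJ n t = t ^ n / Nat.doubleFactorial (2 * n + 1) *
      ∑' l : ℕ, (-t ^ 2 / 2) ^ l * (1 / ((l.factorial : ℝ) * riseTwo (2 * n + 3) l)) := by
  rw [sphericalJ, ← tsum_mul_left]
  refine tsum_congr fun l => ?_
  have h1 := riseTwo_pos (2 * n + 3) (by positivity) l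
  have h2 : (0 : ℝ) < Nat.doubleFactorial (2 * n + 1) := by
    exact_mod_cast Nat.doubleFactorial_pos _
  rw [doubleFactorial_riseTwo, pow_add, pow_mul, div_pow, neg_pow (t ^ 2)]
  field_simp

theorem sphericalY_eq (n : ℕ) (t : ℝ) (ht : t ≠ 0) :
    sphericalY n t = -(((2 * n).factorial : ℝ) / (2 ^ n * n.factorial)) / t ^ (n + 1) *
      ∑' l : ℕ, (-t ^ 2 / 2) ^ l * (1 / ((l.factorial : ℝ) * riseTwo (1 - 2 * n) l)) := by
  rw [sphericalY, div_mul_eq_mul_div, mul_div_assoc, ← tsum_div_const]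
  congr 1
  refine tsum_congr fun l => ?_
  have h1 : riseTwo (1 - 2 * n) l ≠ 0 := fun h => by
    have := one_le_abs_riseTwo_odd n l
    norm_num [h] at this
  have h2 : ∏ i ∈ Finset.range l, (-2 * (n : ℝ) + 2 * (i : ℝ) + 1) = riseTwo (1 - 2 * n) l :=
    Finset.prod_congr rfl fun i _ => by ring
  have h3 : t ^ (2 * (l : ℤ) - n - 1) = (t ^ 2) ^ l / t ^ (n + 1) := by
    rw [sub_sub, zpow_sub₀ ht, zpow_mul]
    norm_cast
  rw [h2, h3, div_pow, neg_pow (t ^ 2)]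
  field_simp

theorem one_le_abs_riseTwo (α : ℝ) (hα : 1 ≤ α) (n : ℕ) : 1 ≤ |riseTwo α n| := by
  rw [riseTwo, Finset.abs_prod]
  refine Finset.prod_induction _ (fun x : ℝ => 1 ≤ x)
    (fun _ _ ha hb => one_le_mul_of_one_le_of_one_le ha hb) le_rfl fun i _ => ?_
  rw [abs_of_nonneg (by positivity)]
  have : (0 : ℝ) ≤ i := by positivity
  linarith

/-- With parameters `2n + 3` and `1 - 2n`, whose sum is 4, the convolution gives `fallTwo (4N) N`,
free of `n`. The powers of `k` in front of the two series combine to `1/k`, and the remaining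
constants to `2/(2n + 1)`. -/
theorem hasSum_even (n : ℕ) (k : ℝ) (hk : k ≠ 0) :
    HasSum (fun N : ℕ => (-1) ^ N * k ^ (2 * N) / (2 * N).factorial *
        (2 ^ (2 * N) * cauchySum n (((2 * N : ℕ) + 1) / 2)))
      (-2 * k * (sphericalJ n k * sphericalY n k)) := by
  have h := (hasSum_product (-k ^ 2 / 2) (2 * n + 3) (1 - 2 * n)
    (one_le_abs_riseTwo _ (by linarith [show (0 : ℝ) ≤ n by positivity]))
    (one_le_abs_riseTwo_odd n)).mul_left (2 / (2 * n + 1 : ℝ))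
  rw [sphericalJ_eq, sphericalY_eq n k hk]
  have hd : (0 : ℝ) < Nat.doubleFactorial (2 * n + 1) := by
    exact_mod_cast Nat.doubleFactorial_pos _
  convert! h using 1
  · ext N
    have h1 := cauchySum_even n N
    have h2 := fallTwo_two_mul N N
    have p1 := (riseTwo_pos (2 * n + 3) (by positivity) N).ne'
    have p2 : riseTwo (1 - 2 * n) N ≠ 0 := fun h => by
      have := one_le_abs_riseTwo_odd n N
      norm_num [h] at this
    rw [show (2 * (n : ℝ) + 3 + (1 - 2 * n) + 4 * N - 4) = 2 * ((N + N : ℕ) : ℝ) by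
      push_cast; ring]
    have e1 : fallTwo (2 * ((N + N : ℕ) : ℝ)) N = 2 ^ N * (2 * N).factorial / N.factorial := by
      rw [eq_div_iff (by positivity), h2, two_mul]
    have e2 : cauchySum n (N + 1 / 2) = 2 * (2 * N).factorial ^ 2 / (4 ^ N *
        ((2 * n + 1) * N.factorial ^ 2 * riseTwo (2 * n + 3) N * riseTwo (1 - 2 * n) N)) := by
      rw [← h1]; field_simp
    have e3 : (((2 * N : ℕ) : ℝ) + 1) / 2 = N + 1 / 2 := by push_cast; ring
    rw [e3, e1, e2, pow_mul, pow_mul, div_pow, neg_pow (k ^ 2)]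
    norm_num
    field_simp
  · have h3 := doubleFactorial_odd_mul n
    rw [Nat.factorial_succ] at h3
    push_cast at h3
    have e : (Nat.doubleFactorial (2 * n + 1) : ℝ) =
        (2 * n + 1) * (2 * n).factorial / (2 ^ n * n.factorial) := by
      rw [← h3]; field_simp
    rw [e]
    generalize (∑' l : ℕ, (-k ^ 2 / 2) ^ l * (1 / ((l.factorial : ℝ) * riseTwo (2 * n + 3) l))) = A
    generalize (∑' l : ℕ, (-k ^ 2 / 2) ^ l * (1 / ((l.factorial : ℝ) * riseTwo (1 - 2 * n) l))) = B
    rw [pow_succ]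
    field_simp

theorem hasSum_odd (n : ℕ) (k : ℝ) :
    HasSum (fun q : ℕ => (-1) ^ q * k ^ (2 * q + 1) / (2 * q + 1).factorial *
        (2 ^ (2 * q + 1) * cauchySum n (((2 * q + 1 : ℕ) + 1) / 2)))
      (2 * k * sphericalJ n k ^ 2) := by
  have h := (hasSum_product (-k ^ 2 / 2) (2 * n + 3) (2 * n + 3)
    (one_le_abs_riseTwo _ (by linarith [show (0 : ℝ) ≤ n by positivity]))
    (one_le_abs_riseTwo _ (by linarith [show (0 : ℝ) ≤ n by positivity]))).mul_left
      (2 * k * (k ^ n / Nat.doubleFactorial (2 * n + 1)) ^ 2)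
  have hd : (0 : ℝ) < Nat.doubleFactorial (2 * n + 1) := by
    exact_mod_cast Nat.doubleFactorial_pos _
  -- The first `n` odd moments vanish by orthogonality, which matches the factor `k^(2n)` in `j_n²`;
  -- the series is therefore compared from index `n` on.
  rw [← hasSum_nat_add_iff' n, sphericalJ_eq, Finset.sum_eq_zero, sub_zero]
  · convert! h using 1
    · ext N
      have h1 := cauchySum_odd n N
      have h2 := fallTwo_two_mul (2 * n + N + 1) N
      have h3 := doubleFactorial_riseTwo n N
      have h4 := doubleFactorial_odd_mul (n + N)
      have p1 := (riseTwo_pos (2 * n + 3) (by positivity) N).ne'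
      rw [show (2 * (n : ℝ) + 3 + (2 * n + 3) + 4 * N - 4) = 2 * ((2 * n + N + 1 + N : ℕ) : ℝ) by
        push_cast; ring]
      rw [show 2 * n + N + 1 + N = 2 * (n + N) + 1 by ring] at h2 ⊢
      rw [show 2 * n + 2 * N + 1 = 2 * (n + N) + 1 by ring] at h3
      have e1 : fallTwo (2 * ((2 * (n + N) + 1 : ℕ) : ℝ)) N =
          2 ^ N * (2 * (n + N) + 1).factorial / (2 * n + N + 1).factorial := by
        rw [eq_div_iff (by positivity), h2]
      have e2 : cauchySum n ((n + N : ℕ) + 1) =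
          (-1) ^ n * (n + N).factorial ^ 2 / (N.factorial * (2 * n + N + 1).factorial) := by
        rw [← h1]; field_simp
      have e3 : (((2 * (n + N) + 1 : ℕ) : ℝ) + 1) / 2 = (n + N : ℕ) + 1 := by push_cast; ring
      rw [add_comm N n, e3, e1, e2, ← h4, h3, pow_succ, pow_succ, pow_mul, pow_mul,
        div_pow (-k ^ 2), neg_pow (k ^ 2)]
      have e4 : ((-1 : ℝ) ^ n) * (-1) ^ n = 1 := by rw [← mul_pow]; simp
      have e5 : (2 : ℝ) ^ (n + N) * 2 ^ (n + N) = (2 ^ 2) ^ (n + N) := by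
        rw [← mul_pow]; norm_num
      rw [← e5, pow_add (-1 : ℝ)]
      field_simp
      linear_combination (k * (k ^ 2) ^ (n + N)) * e4
    · ring
  · intro q hq
    rw [show (((2 * q + 1 : ℕ) : ℝ) + 1) / 2 = q + 1 by push_cast; ring,
      cauchySum_odd_of_lt n q (Finset.mem_range.1 hq)]
    simp

theorem integral_exp_mul_legendreP (n : ℕ) (k : ℝ) (hk : k ≠ 0) :
    ∫ s in (0 : ℝ)..2, Complex.exp (Complex.I * k * s) *
        (((legendreP n).eval (1 - s ^ 2 / 2) : ℝ) : ℂ) =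
      2 * Complex.I * k * (sphericalJ n k * sphericalH1 n k) := by
  refine (hasSum_integral_exp_mul_legendreP n k).unique ?_
  have h1 := Complex.hasSum_ofReal.2 (hasSum_even n k hk)
  have h2 := (Complex.hasSum_ofReal.2 (hasSum_odd n k)).mul_left Complex.I
  -- Since `h = j + iy`, the real part `-2k j y` collects the even powers of `ik`, and the imaginary
  -- part `2k j²` the odd ones.
  have e : 2 * Complex.I * k * (sphericalJ n k * sphericalH1 n k) =
      ((-2 * k * (sphericalJ n k * sphericalY n k) : ℝ) : ℂ) +
        Complex.I * ((2 * k * sphericalJ n k ^ 2 : ℝ) : ℂ) := by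
    rw [sphericalH1]
    push_cast
    linear_combination 2 * (k : ℂ) * sphericalJ n k * sphericalY n k * Complex.I_sq
  rw [e]
  refine HasSum.even_add_odd ?_ ?_
  · convert! h1 using 2 with N
    rw [mul_pow, pow_mul Complex.I, Complex.I_sq]
    push_cast
    ring
  · convert! h2 using 2 with N
    rw [mul_pow, pow_succ Complex.I, pow_mul Complex.I, Complex.I_sq]
    push_cast
    ring

/-! ### Spherical coordinates and the surface measure -/

open scoped ENNReal Pointwise

/-- The point of the unit sphere with height `t` and longitude `φ`. -/
def spherePoint (t φ : ℝ) : E3 :=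
  !₂[Real.sqrt (1 - t ^ 2) * Real.cos φ, Real.sqrt (1 - t ^ 2) * Real.sin φ, t]

theorem measurable_spherePoint : Measurable fun p : ℝ × ℝ => spherePoint p.1 p.2 := by
  refine Continuous.measurable ?_
  refine (PiLp.continuous_toLp 2 _).comp (continuous_pi fun i => ?_)
  fin_cases i <;> simp <;> fun_prop

theorem norm_spherePoint {t : ℝ} (ht : t ∈ Ioo (-1 : ℝ) 1) (φ : ℝ) : ‖spherePoint t φ‖ = 1 := by
  have h : 0 ≤ 1 - t ^ 2 := by nlinarith [ht.1, ht.2]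
  rw [EuclideanSpace.norm_eq, Real.sqrt_eq_one, Fin.sum_univ_three]
  simp only [spherePoint, Real.norm_eq_abs, sq_abs]
  simp only [Matrix.cons_val_zero, Matrix.cons_val_one, Matrix.cons_val]
  linear_combination (Real.cos φ ^ 2 + Real.sin φ ^ 2) * Real.sq_sqrt h
    + (1 - t ^ 2) * Real.cos_sq_add_sin_sq φ

theorem lintegral_E3_eq_prod (F : E3 → ℝ≥0∞) (hF : Measurable F) :
    ∫⁻ y, F y = ∫⁻ q : ℝ × (ℝ × ℝ), F !₂[q.2.1, q.2.2, q.1] := by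
  have h1 := PiLp.volume_preserving_toLp (Fin 3)
  have h2 := (volume_preserving_piFinSuccAbove (fun _ : Fin 3 => ℝ) 2).symm
  have h3 := (volume_preserving_finTwoArrow ℝ).symm
  have h4 := h1.comp (h2.comp ((MeasurePreserving.id (volume : Measure ℝ)).prod h3))
  rw [← h4.lintegral_comp hF]
  refine lintegral_congr fun q => ?_
  congr 1
  ext i
  fin_cases i <;> rfl

theorem lintegral_Ioo_sin_mul (G : ℝ → ℝ → ℝ≥0∞) :
    ∫⁻ θ in Ioo 0 Real.pi, ENNReal.ofReal (Real.sin θ) * G (Real.cos θ) (Real.sin θ) =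
      ∫⁻ t in Ioo (-1 : ℝ) 1, G t (Real.sqrt (1 - t ^ 2)) := by
  have himg : Real.cos '' Ioo 0 Real.pi = Ioo (-1) 1 := by
    ext t
    constructor
    · rintro ⟨θ, hθ, rfl⟩
      constructor
      · rw [← Real.cos_pi]
        exact Real.strictAntiOn_cos ⟨hθ.1.le, hθ.2.le⟩ ⟨Real.pi_pos.le, le_rfl⟩ hθ.2
      · rw [← Real.cos_zero]
        exact Real.strictAntiOn_cos ⟨le_rfl, Real.pi_pos.le⟩ ⟨hθ.1.le, hθ.2.le⟩ hθ.1
    · intro ht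
      refine ⟨Real.arccos t, ⟨Real.arccos_pos.2 ht.2, ?_⟩, Real.cos_arccos ht.1.le ht.2.le⟩
      refine lt_of_le_of_ne (Real.arccos_le_pi t) fun h => ?_
      rw [Real.arccos_eq_pi] at h
      linarith [ht.1]
  have h := lintegral_image_eq_lintegral_abs_deriv_mul (s := Ioo 0 Real.pi) measurableSet_Ioo
    (fun θ _ => (Real.hasDerivAt_cos θ).hasDerivWithinAt)
    (Real.injOn_cos.mono Ioo_subset_Icc_self) (fun t => G t (Real.sqrt (1 - t ^ 2)))
  rw [← himg, h]
  refine setLIntegral_congr_fun measurableSet_Ioo fun θ hθ => ?_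
  have hs := Real.sin_pos_of_mem_Ioo hθ
  have : Real.sqrt (1 - Real.cos θ ^ 2) = Real.sin θ := by
    rw [← Real.sin_sq, Real.sqrt_sq hs.le]
  simp only [this, abs_neg, abs_of_pos hs]

/-- Polar coordinates `z = r cos θ`, `ρ = r sin θ` produce the weight `r² sin θ`, and `sin θ dθ`
becomes `dt` for `t = cos θ`. The indicator of `ρ > 0` cuts `θ` down to `(0, π)`. -/
theorem lintegral_halfPlane (H : ℝ × ℝ → ℝ≥0∞) (hH : Measurable H) :
    ∫⁻ z : ℝ, ∫⁻ ρ in Ioi (0 : ℝ), ENNReal.ofReal ρ * H (z, ρ) =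
      ∫⁻ r in Ioi (0 : ℝ), ENNReal.ofReal (r ^ 2) *
        ∫⁻ t in Ioo (-1 : ℝ) 1, H (r * t, r * Real.sqrt (1 - t ^ 2)) := by
  have hK : Measurable fun p : ℝ × ℝ => (Ioi (0 : ℝ)).indicator
      (fun ρ => ENNReal.ofReal ρ * H (p.1, ρ)) p.2 := by
    have : (fun p : ℝ × ℝ => (Ioi (0 : ℝ)).indicator
      (fun ρ => ENNReal.ofReal ρ * H (p.1, ρ)) p.2) = (univ ×ˢ Ioi (0 : ℝ)).indicator
      (fun p : ℝ × ℝ => ENNReal.ofReal p.2 * H p) := by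
      ext p
      simp [indicator]
    rw [this]
    exact (by fun_prop : Measurable _).indicator (MeasurableSet.univ.prod measurableSet_Ioi)
  calc
    _ = ∫⁻ p : ℝ × ℝ, (Ioi (0 : ℝ)).indicator
          (fun ρ => ENNReal.ofReal ρ * H (p.1, ρ)) p.2 := by
        rw [Measure.volume_eq_prod, lintegral_prod _ hK.aemeasurable]
        simp_rw [lintegral_indicator measurableSet_Ioi]
    _ = ∫⁻ r in Ioi (0 : ℝ), ∫⁻ θ in Ioo (-Real.pi) Real.pi, ENNReal.ofReal r *
          (Ioi (0 : ℝ)).indicator (fun ρ => ENNReal.ofReal ρ * H (r * Real.cos θ, ρ))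
            (r * Real.sin θ) := by
        rw [← lintegral_comp_polarCoord_symm]
        simp only [polarCoord_target, smul_eq_mul, polarCoord_symm_apply]
        rw [Measure.volume_eq_prod, ← Measure.prod_restrict, lintegral_prod]
        refine Measurable.aemeasurable ?_
        refine (by fun_prop : Measurable fun p : ℝ × ℝ => ENNReal.ofReal p.1).mul ?_
        exact hK.comp (by fun_prop : Measurable fun p : ℝ × ℝ =>
          (p.1 * Real.cos p.2, p.1 * Real.sin p.2))
    _ = _ := by
        refine setLIntegral_congr_fun measurableSet_Ioi fun r hr => ?_
        have hr' : 0 < r := hr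
        have h1 : ∫⁻ θ in Ioo (-Real.pi) Real.pi, ENNReal.ofReal r *
          (Ioi (0 : ℝ)).indicator (fun ρ => ENNReal.ofReal ρ * H (r * Real.cos θ, ρ))
            (r * Real.sin θ) = ∫⁻ θ in Ioo (-Real.pi) Real.pi, (Ioo 0 Real.pi).indicator
              (fun θ => ENNReal.ofReal (r ^ 2) * (ENNReal.ofReal (Real.sin θ) *
                H (r * Real.cos θ, r * Real.sin θ))) θ := by
          refine setLIntegral_congr_fun measurableSet_Ioo fun θ hθ => ?_
          by_cases h : 0 < θ
          · have hs := Real.sin_pos_of_pos_of_lt_pi h hθ.2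
            rw [indicator_of_mem (show θ ∈ Ioo 0 Real.pi from ⟨h, hθ.2⟩),
              indicator_of_mem (show r * Real.sin θ ∈ Ioi 0 from mul_pos hr' hs),
              ENNReal.ofReal_mul hr'.le, sq, ENNReal.ofReal_mul hr'.le]
            ring
          · have hs := Real.sin_nonpos_of_nonpos_of_neg_pi_le (not_lt.1 h) hθ.1.le
            have h2 : θ ∉ Ioo 0 Real.pi := fun h' => h h'.1
            have h3 : r * Real.sin θ ∉ Ioi (0 : ℝ) :=
              not_lt.2 (mul_nonpos_of_nonneg_of_nonpos hr'.le hs)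
            rw [indicator_of_notMem h2, indicator_of_notMem h3, mul_zero]
        rw [h1, lintegral_indicator measurableSet_Ioo, Measure.restrict_restrict measurableSet_Ioo,
          inter_eq_left.2 (Ioo_subset_Ioo_left (by linarith [Real.pi_pos])),
          lintegral_const_mul _ (by fun_prop),
          lintegral_Ioo_sin_mul (fun c s => H (r * c, r * s))]

/-- Polar coordinates are used twice: in the horizontal plane, and then in the half-plane of height
and distance to the axis. -/
theorem lintegral_E3_eq_spherical (F : E3 → ℝ≥0∞) (hF : Measurable F) :
    ∫⁻ y, F y = ∫⁻ r in Ioi (0 : ℝ), ENNReal.ofReal (r ^ 2) *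
      ∫⁻ t in Ioo (-1 : ℝ) 1, ∫⁻ φ in Ioo (-Real.pi) Real.pi, F (r • spherePoint t φ) := by
  have hm : Measurable fun q : ℝ × (ℝ × ℝ) => F !₂[q.2.1, q.2.2, q.1] := by
    refine hF.comp (Continuous.measurable ?_)
    refine (PiLp.continuous_toLp 2 _).comp (continuous_pi fun i => ?_)
    fin_cases i <;> simp <;> fun_prop
  have hm2 : Measurable fun q : (ℝ × ℝ) × ℝ =>
      F !₂[q.1.2 * Real.cos q.2, q.1.2 * Real.sin q.2, q.1.1] :=
    hm.comp (by fun_prop : Measurable fun q : (ℝ × ℝ) × ℝ =>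
      (q.1.1, (q.1.2 * Real.cos q.2, q.1.2 * Real.sin q.2)))
  rw [lintegral_E3_eq_prod _ hF, Measure.volume_eq_prod, lintegral_prod _ hm.aemeasurable]
  have h1 (z : ℝ) : ∫⁻ y : ℝ × ℝ, F !₂[y.1, y.2, z] = ∫⁻ ρ in Ioi (0 : ℝ), ENNReal.ofReal ρ *
      ∫⁻ φ in Ioo (-Real.pi) Real.pi, F !₂[ρ * Real.cos φ, ρ * Real.sin φ, z] := by
    rw [← lintegral_comp_polarCoord_symm]
    simp only [polarCoord_target, smul_eq_mul, polarCoord_symm_apply]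
    have hm3 : Measurable fun p : ℝ × ℝ =>
        F !₂[p.1 * Real.cos p.2, p.1 * Real.sin p.2, z] :=
      hm2.comp (by fun_prop : Measurable fun p : ℝ × ℝ => ((z, p.1), p.2))
    rw [Measure.volume_eq_prod, ← Measure.prod_restrict, lintegral_prod]
    · refine lintegral_congr fun ρ => ?_
      simp only
      rw [lintegral_const_mul]
      exact hm3.comp (by fun_prop : Measurable fun φ : ℝ => (ρ, φ))
    · exact ((by fun_prop : Measurable fun p : ℝ × ℝ => ENNReal.ofReal p.1).mul hm3).aemeasurable
  simp_rw [h1]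
  rw [lintegral_halfPlane (fun p => ∫⁻ φ in Ioo (-Real.pi) Real.pi,
    F !₂[p.2 * Real.cos φ, p.2 * Real.sin φ, p.1]) hm2.lintegral_prod_right']
  have h2 (r t φ : ℝ) : r • spherePoint t φ = !₂[r * Real.sqrt (1 - t ^ 2) * Real.cos φ,
      r * Real.sqrt (1 - t ^ 2) * Real.sin φ, r * t] := by
    ext i
    fin_cases i <;> simp [spherePoint, mul_assoc]
  simp_rw [h2]

/-- Archimedes' theorem: height and longitude preserve area. By definition the surface measure is
three times the volume of the cone over `A`, whose radial integral `∫₀¹ r² dr = 1/3` cancels the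
three. -/
theorem surface_apply (A : Set S2) (hA : MeasurableSet A) :
    surface A = volume ((Ioo (-1 : ℝ) 1 ×ˢ Ioo (-Real.pi) Real.pi) ∩
      (fun p : ℝ × ℝ => spherePoint p.1 p.2) ⁻¹' ((↑) '' A : Set E3)) := by
  have hA' : MeasurableSet ((↑) '' A : Set E3) :=
    (MeasurableEmbedding.subtype_coe Metric.isClosed_sphere.measurableSet).measurableSet_image.2 hA
  have hcone : (Ioo (0 : ℝ) 1 • ((↑) '' A) : Set E3) =
      {y | ‖y‖ ∈ Ioo (0 : ℝ) 1} ∩ (fun y : E3 => ‖y‖⁻¹ • y) ⁻¹' ((↑) '' A) := by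
    ext y
    constructor
    · rintro ⟨r, hr, -, ⟨a, ha, rfl⟩, rfl⟩
      have hn : ‖r • (a : E3)‖ = r := by
        rw [norm_smul, norm_eq_of_mem_sphere, mul_one, Real.norm_of_nonneg hr.1.le]
      refine ⟨?_, ?_⟩
      · simpa only [mem_ofPred_eq, hn] using hr
      · simp only [mem_preimage, hn]
        rw [smul_smul, inv_mul_cancel₀ hr.1.ne', one_smul]
        exact ⟨a, ha, rfl⟩
    · rintro ⟨h1, h2⟩
      refine ⟨‖y‖, h1, _, h2, ?_⟩
      simp only
      rw [smul_smul, mul_inv_cancel₀ h1.1.ne', one_smul]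
  have hcm : MeasurableSet (Ioo (0 : ℝ) 1 • ((↑) '' A) : Set E3) := by
    rw [hcone]
    exact (measurable_norm measurableSet_Ioo).inter
      ((by fun_prop : Measurable fun y : E3 => ‖y‖⁻¹ • y) hA')
  have hpre := measurable_spherePoint hA'
  rw [surface, Measure.toSphere_apply' _ hA, ← lintegral_indicator_one hcm,
    lintegral_E3_eq_spherical _ (measurable_one.indicator hcm)]
  have key : ∀ r ∈ Ioi (0 : ℝ), ENNReal.ofReal (r ^ 2) *
      (∫⁻ t in Ioo (-1 : ℝ) 1, ∫⁻ φ in Ioo (-Real.pi) Real.pi,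
        (Ioo (0 : ℝ) 1 • ((↑) '' A) : Set E3).indicator 1 (r • spherePoint t φ)) =
      (Iio (1 : ℝ)).indicator (fun r => ENNReal.ofReal (r ^ 2)) r *
      (∫⁻ t in Ioo (-1 : ℝ) 1, ∫⁻ φ in Ioo (-Real.pi) Real.pi,
        ((↑) '' A : Set E3).indicator 1 (spherePoint t φ)) := by
    intro r hr
    have hr' : 0 < r := hr
    by_cases h : r < 1
    · rw [indicator_of_mem (show r ∈ Iio 1 from h)]
      congr 1
      refine setLIntegral_congr_fun measurableSet_Ioo fun t ht => ?_
      refine lintegral_congr fun φ => ?_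
      have hn : ‖r • spherePoint t φ‖ = r := by
        rw [norm_smul, norm_spherePoint ht, mul_one, Real.norm_of_nonneg hr'.le]
      have : r • spherePoint t φ ∈ (Ioo (0 : ℝ) 1 • ((↑) '' A) : Set E3) ↔
          spherePoint t φ ∈ ((↑) '' A : Set E3) := by
        rw [hcone, mem_inter_iff, mem_ofPred_eq, hn, mem_preimage, hn, smul_smul,
          inv_mul_cancel₀ hr'.ne', one_smul]
        exact and_iff_right ⟨hr', h⟩
      by_cases h' : spherePoint t φ ∈ ((↑) '' A : Set E3)
      · rw [indicator_of_mem h', indicator_of_mem (this.2 h'), Pi.one_apply, Pi.one_apply]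
      · rw [indicator_of_notMem h', indicator_of_notMem (h' ∘ this.1)]
    · rw [indicator_of_notMem (show r ∉ Iio 1 from h), zero_mul]
      have : ∫⁻ t in Ioo (-1 : ℝ) 1, ∫⁻ φ in Ioo (-Real.pi) Real.pi,
        (Ioo (0 : ℝ) 1 • ((↑) '' A) : Set E3).indicator 1 (r • spherePoint t φ) =
          ∫⁻ t in Ioo (-1 : ℝ) 1, 0 := by
        refine setLIntegral_congr_fun measurableSet_Ioo fun t ht => ?_
        rw [← lintegral_zero]
        refine lintegral_congr fun φ => ?_
        have hn : ‖r • spherePoint t φ‖ = r := by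
          rw [norm_smul, norm_spherePoint ht, mul_one, Real.norm_of_nonneg hr'.le]
        rw [indicator_of_notMem]
        rw [hcone, mem_inter_iff, mem_ofPred_eq, hn]
        exact fun h' => h h'.1.2
      rw [this, lintegral_zero, mul_zero]
  rw [setLIntegral_congr_fun measurableSet_Ioi key, lintegral_mul_const _ (by
    exact (by fun_prop : Measurable fun r : ℝ => ENNReal.ofReal (r ^ 2)).indicator measurableSet_Iio)]
  have hrad : ∫⁻ r in Ioi (0 : ℝ), (Iio (1 : ℝ)).indicator (fun r => ENNReal.ofReal (r ^ 2)) r =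
      ENNReal.ofReal (1 / 3) := by
    rw [lintegral_indicator measurableSet_Iio, Measure.restrict_restrict measurableSet_Iio,
      inter_comm, Ioi_inter_Iio, restrict_Ioo_eq_restrict_Ioc,
      ← ofReal_integral_eq_lintegral_ofReal (intervalIntegral.intervalIntegrable_pow _).1
        (ae_of_all _ fun _ => sq_nonneg _), ← intervalIntegral.integral_of_le zero_le_one]
    norm_num [integral_pow]
  have hdim : (Module.finrank ℝ E3 : ℝ≥0∞) * ENNReal.ofReal (1 / 3) = 1 := by
    rw [finrank_euclideanSpace_fin, show ((3 : ℕ) : ℝ≥0∞) = ENNReal.ofReal 3 by norm_num,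
      ← ENNReal.ofReal_mul (by norm_num)]
    norm_num
  rw [hrad, ← mul_assoc, hdim, one_mul, inter_comm, ← Measure.restrict_apply hpre,
    Measure.volume_eq_prod, ← Measure.prod_restrict, ← lintegral_indicator_one hpre, lintegral_prod]
  · rfl
  · exact (measurable_one.indicator hpre).aemeasurable

/-! ### Trinomial coefficients and Laplace's integral for Legendre polynomials -/

/-- The sum such that the coefficient of `X ^ (n + m)` in `(c + a X + b X²) ^ n` is
`b ^ m * trinomialSum n m a (b * c)`. -/
def trinomialSum {R : Type*} [CommRing R] (n m : ℕ) (a d : R) : R :=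
  ∑ j ∈ Finset.range (n + 1), if m ≤ j ∧ 2 ∣ j + m then
    (n.choose j : R) * a ^ (n - j) * (j.choose ((j + m) / 2) : R) * d ^ ((j - m) / 2) else 0

section
open Polynomial
variable {R : Type*} [CommRing R]

theorem coeff_C_add_C_mul_X_pow (b c : R) (j k : ℕ) :
    ((C c + C b * X) ^ j).coeff k = j.choose k * b ^ k * c ^ (j - k) := by
  rw [add_comm, add_pow, finsetSum_coeff]
  rw [Finset.sum_congr rfl (fun i _ => show _ = if k = i then
      (j.choose i : R) * b ^ i * c ^ (j - i) else 0 by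
    rw [mul_pow, ← C_pow, ← C_pow, ← C_eq_natCast,
      show C (b ^ i) * X ^ i * C (c ^ (j - i)) * C (j.choose i : R) =
        C (j.choose i * b ^ i * c ^ (j - i)) * X ^ i by simp only [C_mul]; ring, coeff_C_mul_X_pow])]
  rw [Finset.sum_ite_eq]
  split_ifs with h
  · rfl
  · rw [Nat.choose_eq_zero_of_lt (by simpa using h)]; simp

theorem coeff_C_add_C_mul_X_sq_pow (b c : R) (j k : ℕ) :
    ((C c + C b * X ^ 2) ^ j).coeff k =
      if 2 ∣ k then j.choose (k / 2) * b ^ (k / 2) * c ^ (j - k / 2) else 0 := by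
  have : (C c + C b * X ^ 2) ^ j = expand R 2 ((C c + C b * X) ^ j) := by simp
  rw [this, coeff_expand two_pos, coeff_C_add_C_mul_X_pow]

theorem trinomial_pow_eq (a b c : R) (n : ℕ) :
    (C c + C a * X + C b * X ^ 2) ^ n = ∑ j ∈ Finset.range (n + 1),
      C ((n.choose j : R) * a ^ (n - j)) * ((C c + C b * X ^ 2) ^ j * X ^ (n - j)) := by
  rw [show C c + C a * X + C b * X ^ 2 = (C c + C b * X ^ 2) + C a * X by ring, add_pow]
  refine Finset.sum_congr rfl fun j _ => ?_
  rw [mul_pow, C_mul, C_pow, ← C_eq_natCast]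
  ring

theorem coeff_trinomial_pow_add (a b c : R) (n m : ℕ) :
    ((C c + C a * X + C b * X ^ 2) ^ n).coeff (n + m) = b ^ m * trinomialSum n m a (b * c) := by
  rw [trinomial_pow_eq, finsetSum_coeff, trinomialSum, Finset.mul_sum]
  refine Finset.sum_congr rfl fun j hj => ?_
  have hj' : j ≤ n := Nat.lt_succ_iff.1 (Finset.mem_range.1 hj)
  rw [coeff_C_mul, coeff_mul_X_pow', if_pos (by omega), show n + m - (n - j) = j + m by omega,
    coeff_C_add_C_mul_X_sq_pow]
  by_cases h2 : 2 ∣ j + m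
  · by_cases hm : m ≤ j
    · rw [if_pos h2, if_pos ⟨hm, h2⟩]
      have e1 : (j + m) / 2 = m + (j - m) / 2 := by omega
      have e2 : j - (j + m) / 2 = (j - m) / 2 := by omega
      rw [e2]
      conv_lhs => rw [show b ^ ((j + m) / 2) = b ^ m * b ^ ((j - m) / 2) by rw [e1, pow_add]]
      rw [mul_pow]
      ring
    · rw [if_pos h2, if_neg (fun h => hm h.1),
        Nat.choose_eq_zero_of_lt (show j < (j + m) / 2 by omega)]
      simp
  · rw [if_neg h2, if_neg (fun h => h2 h.2)]
    simp

theorem coeff_trinomial_pow_sub (a b c : R) (n m : ℕ) (hmn : m ≤ n) :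
    ((C c + C a * X + C b * X ^ 2) ^ n).coeff (n - m) = c ^ m * trinomialSum n m a (b * c) := by
  rw [trinomial_pow_eq, finsetSum_coeff, trinomialSum, Finset.mul_sum]
  refine Finset.sum_congr rfl fun j hj => ?_
  have hj' : j ≤ n := Nat.lt_succ_iff.1 (Finset.mem_range.1 hj)
  rw [coeff_C_mul, coeff_mul_X_pow']
  by_cases hm : m ≤ j
  · rw [if_pos (by omega), show n - m - (n - j) = j - m by omega, coeff_C_add_C_mul_X_sq_pow]
    by_cases h2 : 2 ∣ j + m
    · rw [if_pos (by omega), if_pos ⟨hm, h2⟩]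
      have e1 : j - (j - m) / 2 = m + (j - m) / 2 := by omega
      have e2 : (j + m) / 2 = j - (j - m) / 2 := by omega
      rw [e2, Nat.choose_symm (by omega), e1, pow_add, mul_pow]
      ring
    · rw [if_neg (by omega), if_neg (fun h => h2 h.2)]
      simp
  · rw [if_neg (by omega), if_neg (fun h => hm h.1)]
    simp

theorem trinomialSum_homogeneous (n : ℕ) (l a d : R) :
    trinomialSum n 0 (l * a) (l ^ 2 * d) = l ^ n * trinomialSum n 0 a d := by
  rw [trinomialSum, trinomialSum, Finset.mul_sum]
  refine Finset.sum_congr rfl fun j hj => ?_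
  have hj' : j ≤ n := Nat.lt_succ_iff.1 (Finset.mem_range.1 hj)
  split_ifs with h
  · have e : l ^ n = l ^ (n - j) * (l ^ 2) ^ ((j - 0) / 2) := by
      rw [← pow_mul, ← pow_add]; congr 1; omega
    rw [e, mul_pow, mul_pow]
    ring
  · simp

/-- By Rodrigues' formula, `P_n^{(m)}(t)` is a multiple of the Taylor coefficient of order `n + m`
at `t` of `(X² - 1)^n`, and `(X + t)² - 1 = 2 ((t² - 1)/2 + tX + X²/2)` is a trinomial. -/
theorem trinomialSum_eq_legendreP (n m : ℕ) (t : ℝ) :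
    trinomialSum n m t ((t ^ 2 - 1) / 4) =
      2 ^ m * n.factorial / (n + m).factorial * (derivative^[m] (legendreP n)).eval t := by
  have h1 := coeff_trinomial_pow_add t (1 / 2) ((t ^ 2 - 1) / 2) n m
  have h2 : C ((2 : ℝ) ^ n) * (C ((t ^ 2 - 1) / 2) + C t * X + C (1 / 2) * X ^ 2) ^ n =
      taylor t ((X ^ 2 - 1) ^ n) := by
    rw [taylor_apply, C_pow, ← mul_pow]
    simp only [pow_comp, sub_comp, X_comp, one_comp]
    congr 1
    have : C (2 : ℝ) * (C ((t ^ 2 - 1) / 2) + C t * X + C (1 / 2) * X ^ 2) =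
      C (2 * ((t ^ 2 - 1) / 2)) + 2 * (C t * X) + C (2 * (1 / 2)) * X ^ 2 := by
      simp only [C_mul, map_ofNat]; ring
    rw [this, mul_div_cancel₀ _ (two_ne_zero), mul_one_div_cancel two_ne_zero]
    simp only [C_sub, C_pow, C_1]
    ring
  have h3 := congrArg (fun p => coeff p (n + m)) h2
  simp only [coeff_C_mul, taylor_coeff] at h3
  rw [h1, show 1 / 2 * ((t ^ 2 - 1) / 2) = (t ^ 2 - 1) / 4 by ring] at h3
  have h4 : ((n + m).factorial : ℝ) * (hasseDeriv (n + m) ((X ^ 2 - 1 : ℝ[X]) ^ n)).eval t =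
      (derivative^[n + m] ((X ^ 2 - 1 : ℝ[X]) ^ n)).eval t := by
    rw [← factorial_smul_hasseDeriv]
    simp
  have h5 : (derivative^[m] (legendreP n)).eval t = 1 / (2 ^ n * n.factorial) *
      (derivative^[n + m] ((X ^ 2 - 1 : ℝ[X]) ^ n)).eval t := by
    rw [legendreP, iterate_derivative_C_mul, ← Function.iterate_add_apply, add_comm m n, eval_mul,
      eval_C]
  rw [h5, ← h4, ← h3, one_div_pow]
  field_simp

theorem trinomialSum_ofReal (n m : ℕ) (a d : ℝ) :
    trinomialSum n m (a : ℂ) (d : ℂ) = ((trinomialSum n m a d : ℝ) : ℂ) := by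
  rw [trinomialSum, trinomialSum, Complex.ofReal_sum]
  refine Finset.sum_congr rfl fun j _ => ?_
  split_ifs <;> push_cast <;> rfl

theorem integral_exp_int_mul (m : ℤ) :
    ∫ φ in (-Real.pi)..Real.pi, Complex.exp (m * φ * Complex.I) =
      if m = 0 then 2 * (Real.pi : ℂ) else 0 := by
  split_ifs with h
  · simp [h]; ring
  · have hc : (m : ℂ) * Complex.I ≠ 0 := mul_ne_zero (by exact_mod_cast h) Complex.I_ne_zero
    have := integral_exp_mul_complex (a := -Real.pi) (b := Real.pi) hc
    rw [show (fun φ : ℝ => Complex.exp (m * φ * Complex.I)) =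
      fun φ : ℝ => Complex.exp (m * Complex.I * φ) by ext φ; congr 1; ring, this, div_eq_zero_iff]
    left
    rw [sub_eq_zero, Complex.exp_eq_exp_iff_exists_int]
    exact ⟨m, by push_cast; ring⟩

/-- Integration over the circle isolates the constant term of a Laurent polynomial in `e^{iφ}`,
which is the middle coefficient of the trinomial power. -/
theorem integral_trinomial_pow (a b c : ℂ) (n : ℕ) :
    ∫ φ in (-Real.pi)..Real.pi,
      (a + b * Complex.exp (φ * Complex.I) + c * Complex.exp (-(φ * Complex.I))) ^ n =
      2 * Real.pi * trinomialSum n 0 a (b * c) := by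
  set Q : ℂ[X] := (C c + C a * X + C b * X ^ 2) ^ n with hQ
  have hdeg : Q.natDegree < 2 * n + 1 := by
    refine Nat.lt_succ_of_le ((natDegree_pow_le).trans ?_)
    rw [mul_comm]
    refine Nat.mul_le_mul_right _ ?_
    compute_degree
  have h (φ : ℝ) : (a + b * Complex.exp (φ * Complex.I) + c * Complex.exp (-(φ * Complex.I))) ^ n =
      ∑ j ∈ Finset.range (2 * n + 1), Q.coeff j *
        Complex.exp (((j - n : ℤ) : ℂ) * φ * Complex.I) := by
    have e1 : Complex.exp (-(φ * Complex.I)) * Complex.exp (φ * Complex.I) = 1 := by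
      rw [← Complex.exp_add]; simp
    have e2 : a + b * Complex.exp (φ * Complex.I) + c * Complex.exp (-(φ * Complex.I)) =
        Complex.exp (-(φ * Complex.I)) * (c + a * Complex.exp (φ * Complex.I) +
          b * Complex.exp (φ * Complex.I) ^ 2) := by
      linear_combination (-a - b * Complex.exp (φ * Complex.I)) * e1
    have e3 : (c + a * Complex.exp (φ * Complex.I) + b * Complex.exp (φ * Complex.I) ^ 2) ^ n =
        Q.eval (Complex.exp (φ * Complex.I)) := by
      simp [hQ]
    rw [e2, mul_pow, e3, eval_eq_sum_range' hdeg, Finset.mul_sum]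
    refine Finset.sum_congr rfl fun j _ => ?_
    rw [mul_left_comm, ← Complex.exp_nat_mul, ← Complex.exp_nat_mul, ← Complex.exp_add]
    congr 2
    push_cast
    ring
  simp_rw [h]
  rw [intervalIntegral.integral_finsetSum
    (fun k _ => (by fun_prop : Continuous _).intervalIntegrable _ _)]
  simp_rw [intervalIntegral.integral_const_mul, integral_exp_int_mul]
  rw [Finset.sum_eq_single n]
  · have := coeff_trinomial_pow_add a b c n 0
    rw [add_zero, pow_zero, one_mul] at this
    rw [← this, if_pos (by ring)]
    ring
  · intro j _ hj
    rw [if_neg (by omega), mul_zero]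
  · intro hn
    exact absurd (Finset.mem_range.2 (by omega)) hn

end

/-! ### Invariance of the surface measure and Funk–Hecke for isotropic forms -/

/-- The surface measure of the unit sphere, as a measure on the ambient space. -/
def sphereMeasure : Measure E3 := surface.map (↑)

theorem measurableEmbedding_coe_sphere : MeasurableEmbedding ((↑) : S2 → E3) :=
  MeasurableEmbedding.subtype_coe Metric.isClosed_sphere.measurableSet

theorem sphereMeasure_eq_map : sphereMeasure =
    (((volume : Measure ℝ).restrict (Ioo (-1) 1)).prod
      ((volume : Measure ℝ).restrict (Ioo (-Real.pi) Real.pi))).map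
        fun p => spherePoint p.1 p.2 := by
  ext s hs
  rw [sphereMeasure, measurableEmbedding_coe_sphere.map_apply,
    surface_apply _ (measurableEmbedding_coe_sphere.measurable hs),
    Measure.map_apply measurable_spherePoint hs, Measure.prod_restrict,
    Measure.restrict_apply (measurable_spherePoint hs), ← Measure.volume_eq_prod, inter_comm]
  congr 1
  ext p
  refine and_congr_left fun hp => ?_
  constructor
  · rintro ⟨y, hy, hyp⟩
    have : (y : E3) = spherePoint p.1 p.2 := hyp
    rw [mem_preimage, ← this]
    exact hy
  · intro h
    exact ⟨⟨spherePoint p.1 p.2, by simpa using norm_spherePoint hp.1 p.2⟩, h, rfl⟩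

/-- Linear isometries map cones to cones and preserve Lebesgue measure. -/
theorem sphereMeasure_map_isometry (U : E3 ≃ₗᵢ[ℝ] E3) :
    sphereMeasure.map U = sphereMeasure := by
  ext s hs
  have hU : Measurable U := U.continuous.measurable
  rw [Measure.map_apply hU hs, sphereMeasure, measurableEmbedding_coe_sphere.map_apply,
    measurableEmbedding_coe_sphere.map_apply, surface,
    Measure.toSphere_apply' _ (measurableEmbedding_coe_sphere.measurable hs),
    Measure.toSphere_apply' _ (measurableEmbedding_coe_sphere.measurable (hU hs))]
  congr 1
  rw [← U.measurePreserving.measure_preimage_equiv (f := U.toMeasurableEquiv)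
    (Ioo (0 : ℝ) 1 • (Subtype.val '' ((↑) ⁻¹' s : Set S2)))]
  congr 1
  ext y
  constructor
  · rintro ⟨r, hr, -, ⟨a, ha, rfl⟩, rfl⟩
    exact ⟨r, hr, U a, ⟨⟨U a, by simp⟩, ha, rfl⟩, by simp⟩
  · rintro ⟨r, hr, -, ⟨a, ha, rfl⟩, h⟩
    refine ⟨r, hr, U.symm a, ⟨⟨U.symm a, by simp⟩, by simpa using ha, rfl⟩, ?_⟩
    apply U.injective
    simpa using h

/-- The north pole. -/
def northPole : E3 := EuclideanSpace.single 2 1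

theorem exists_isometry_northPole (x : E3) (hx : ‖x‖ = 1) :
    ∃ U : E3 ≃ₗᵢ[ℝ] E3, U x = northPole :=
  ⟨_, Submodule.reflection_sub (by simp [hx, northPole])⟩

theorem inner_northPole (y : E3) : inner ℝ northPole y = y 2 := by
  simp [northPole, EuclideanSpace.inner_single_left]

theorem integrable_height (g : ℝ → ℂ) (hg : IntegrableOn g (Ioo (-1) 1)) :
    Integrable (fun p : ℝ × ℝ => g p.1) (((volume : Measure ℝ).restrict (Ioo (-1) 1)).prod
      ((volume : Measure ℝ).restrict (Ioo (-Real.pi) Real.pi))) :=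
  Integrable.comp_fst hg _

theorem integrable_zonal (g : ℝ → ℂ) (hgm : Measurable g) (hg : IntegrableOn g (Ioo (-1) 1))
    (x : S2) : Integrable (fun y : S2 => g (inner ℝ (x : E3) (y : E3))) surface := by
  obtain ⟨U, hU⟩ := exists_isometry_northPole x (norm_eq_of_mem_sphere x)
  have hgn (c : E3) : Measurable fun y : E3 => g (inner ℝ c y) := hgm.comp (by fun_prop)
  have h1 : Integrable (fun y : E3 => g (inner ℝ (x : E3) y)) sphereMeasure := by
    have h2 : Integrable (fun y : E3 => g (inner ℝ northPole y)) sphereMeasure := by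
      rw [sphereMeasure_eq_map, integrable_map_measure
        (hgn _).aestronglyMeasurable measurable_spherePoint.aemeasurable]
      convert! integrable_height g hg using 1
      ext p
      simp [inner_northPole, spherePoint]
    rw [← sphereMeasure_map_isometry U, integrable_map_measure
        (hgn _).aestronglyMeasurable U.continuous.measurable.aemeasurable] at h2
    convert! h2 using 1
    ext y
    simp [← hU]
  exact (measurableEmbedding_coe_sphere.integrable_map_iff).1 h1

/-- The complex linear form with real part `⟪a, ·⟫` and imaginary part `⟪b, ·⟫`. -/
def complexForm (a b y : E3) : ℂ := (inner ℝ a y : ℝ) + Complex.I * (inner ℝ b y : ℝ)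

/-- The hypotheses say that `ζ = a + ib` satisfies `ζ · ζ = 0`. On a circle of latitude `ζ · y` is a
trinomial in `e^{±iφ}`, and isotropy makes the product of its outer coefficients `ζ₂² (t² - 1)/4`;
homogeneity then extracts `ζ₂^n` and leaves `P_n(t)`. -/
theorem integral_complexForm_pow_spherePoint (n : ℕ) (a b : E3) (hab : ‖a‖ = ‖b‖)
    (h0 : inner ℝ a b = 0) {t : ℝ} (ht : t ∈ Ioo (-1 : ℝ) 1) :
    ∫ φ in Ioo (-Real.pi) Real.pi, complexForm a b (spherePoint t φ) ^ n =
      2 * Real.pi * (((legendreP n).eval t : ℝ) : ℂ) * complexForm a b northPole ^ n := by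
  set s := Real.sqrt (1 - t ^ 2) with hs
  have hs2 : s ^ 2 = 1 - t ^ 2 := Real.sq_sqrt (by nlinarith [ht.1, ht.2])
  set z0 : ℂ := a 0 + Complex.I * b 0 with hz0
  set z1 : ℂ := a 1 + Complex.I * b 1 with hz1
  set z2 : ℂ := a 2 + Complex.I * b 2 with hz2
  have hiso : z0 ^ 2 + z1 ^ 2 + z2 ^ 2 = 0 := by
    have e1 : a 0 ^ 2 + a 1 ^ 2 + a 2 ^ 2 = b 0 ^ 2 + b 1 ^ 2 + b 2 ^ 2 := by
      have := congrArg (· ^ 2) hab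
      simpa [EuclideanSpace.real_norm_sq_eq, Fin.sum_univ_three] using this
    have e2 : a 0 * b 0 + a 1 * b 1 + a 2 * b 2 = 0 := by
      have := h0
      simp [PiLp.inner_apply, Fin.sum_univ_three] at this
      linarith
    have e1' : (a 0 : ℂ) ^ 2 + a 1 ^ 2 + a 2 ^ 2 = b 0 ^ 2 + b 1 ^ 2 + b 2 ^ 2 := by exact_mod_cast e1
    have e2' : (a 0 : ℂ) * b 0 + a 1 * b 1 + a 2 * b 2 = 0 := by
      have := congrArg (fun r : ℝ => (r : ℂ)) e2
      push_cast at this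
      exact this
    rw [hz0, hz1, hz2]
    linear_combination e1' + 2 * Complex.I * e2' +
      ((b 0 : ℂ) ^ 2 + b 1 ^ 2 + b 2 ^ 2) * Complex.I_sq
  have hpole : complexForm a b northPole = z2 := by
    rw [complexForm, real_inner_comm, inner_northPole, real_inner_comm, inner_northPole]
  have hform (φ : ℝ) : complexForm a b (spherePoint t φ) = z2 * t +
      s / 2 * (z0 - Complex.I * z1) * Complex.exp (φ * Complex.I) +
      s / 2 * (z0 + Complex.I * z1) * Complex.exp (-(φ * Complex.I)) := by
    have e : complexForm a b (spherePoint t φ) =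
        z2 * t + s * (z0 * Complex.cos φ + z1 * Complex.sin φ) := by
      simp only [complexForm, spherePoint, PiLp.inner_apply, Fin.sum_univ_three]
      simp [hz0, hz1, hz2, ← hs]
      ring
    rw [e, ← neg_mul, Complex.exp_mul_I, Complex.exp_mul_I, Complex.cos_neg, Complex.sin_neg]
    linear_combination (s * z1 * Complex.sin φ) * Complex.I_sq
  simp_rw [hform]
  rw [← integral_Ioc_eq_integral_Ioo, ← intervalIntegral.integral_of_le (by linarith [Real.pi_pos]),
    integral_trinomial_pow, hpole]
  have hbc : s / 2 * (z0 - Complex.I * z1) * (s / 2 * (z0 + Complex.I * z1)) =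
      z2 ^ 2 * ((((t ^ 2 - 1) / 4 : ℝ)) : ℂ) := by
    have hs2' : (s : ℂ) ^ 2 = 1 - (t : ℂ) ^ 2 := by exact_mod_cast hs2
    push_cast
    linear_combination (s : ℂ) ^ 2 / 4 * hiso - (s : ℂ) ^ 2 / 4 * z1 ^ 2 * Complex.I_sq
      - z2 ^ 2 / 4 * hs2'
  rw [hbc, trinomialSum_homogeneous, trinomialSum_ofReal, trinomialSum_eq_legendreP]
  have : (n.factorial : ℝ) ≠ 0 := by positivity
  simp [this]
  ring

theorem continuous_complexForm (a b : E3) : Continuous (complexForm a b) := by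
  unfold complexForm
  fun_prop

theorem integrable_zonal_mul (g : ℝ → ℂ) (hgm : Measurable g) (hg : IntegrableOn g (Ioo (-1) 1))
    (x : S2) (ψ : S2 → ℂ) (hψ : Continuous ψ) :
    Integrable (fun y : S2 => g (inner ℝ (x : E3) (y : E3)) * ψ y) surface := by
  obtain ⟨C, hC⟩ := (isCompact_univ (X := S2)).exists_bound_of_continuousOn hψ.continuousOn
  exact (integrable_zonal g hgm hg x).mul_bdd (c := C) hψ.aestronglyMeasurable
    (ae_of_all _ fun y => hC y (mem_univ y))

/-- The Funk–Hecke formula for powers of isotropic linear forms. -/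
theorem funkHecke_complexForm (g : ℝ → ℂ) (hgm : Measurable g) (hg : IntegrableOn g (Ioo (-1) 1))
    (n : ℕ) (a b : E3) (hab : ‖a‖ = ‖b‖) (h0 : inner ℝ a b = 0) (x : S2) :
    ∫ y : S2, g (inner ℝ (x : E3) (y : E3)) * complexForm a b y ^ n ∂surface =
      2 * Real.pi * (∫ t in Ioo (-1 : ℝ) 1, g t * (((legendreP n).eval t : ℝ) : ℂ)) *
        complexForm a b x ^ n := by
  -- Moving `x` to the pole turns `x · y` into the height. The form stays isotropic because `U`
  -- preserves norms and inner products.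
  obtain ⟨U, hU⟩ := exists_isometry_northPole x (norm_eq_of_mem_sphere x)
  have hU' (c y : E3) : inner ℝ c (U.symm y) = inner ℝ (U c) y := by
    rw [← U.inner_map_map, U.apply_symm_apply]
  have hform (y : E3) : complexForm a b (U.symm y) = complexForm (U a) (U b) y := by
    simp only [complexForm, hU']
  have hx : complexForm a b x = complexForm (U a) (U b) northPole := by
    rw [← hform, ← hU, U.symm_apply_apply]
  have hm : Measurable fun y : E3 => g (inner ℝ northPole y) * complexForm (U a) (U b) y ^ n :=
    (hgm.comp (by fun_prop)).mul ((continuous_complexForm _ _).pow n).measurable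
  have hint : Integrable (fun y : E3 => g (inner ℝ northPole y) * complexForm (U a) (U b) y ^ n)
      sphereMeasure := by
    have hnp : ‖northPole‖ = 1 := by simp [northPole]
    exact measurableEmbedding_coe_sphere.integrable_map_iff.2
      (integrable_zonal_mul g hgm hg ⟨northPole, by simpa using hnp⟩
        (fun y => complexForm (U a) (U b) y ^ n)
        (((continuous_complexForm _ _).pow n).comp continuous_subtype_val))
  calc ∫ y : S2, g (inner ℝ (x : E3) (y : E3)) * complexForm a b y ^ n ∂surface
      = ∫ y, g (inner ℝ (x : E3) y) * complexForm a b y ^ n ∂sphereMeasure :=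
        (measurableEmbedding_coe_sphere.integral_map
          (fun y : E3 => g (inner ℝ (x : E3) y) * complexForm a b y ^ n)).symm
    _ = ∫ y, g (inner ℝ northPole y) * complexForm (U a) (U b) y ^ n ∂sphereMeasure := by
        conv_lhs => rw [← sphereMeasure_map_isometry U.symm]
        rw [MeasurableEmbedding.integral_map (f := U.symm)
          U.symm.toMeasurableEquiv.measurableEmbedding]
        simp only [hU', hform, hU]
    _ = ∫ t in Ioo (-1 : ℝ) 1, ∫ φ in Ioo (-Real.pi) Real.pi,
          g t * complexForm (U a) (U b) (spherePoint t φ) ^ n := by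
        rw [sphereMeasure_eq_map] at hint ⊢
        rw [integrable_map_measure hm.aestronglyMeasurable
          measurable_spherePoint.aemeasurable] at hint
        rw [integral_map measurable_spherePoint.aemeasurable hm.aestronglyMeasurable]
        refine (integral_prod _ hint).trans ?_
        simp [inner_northPole, spherePoint]
    _ = ∫ t in Ioo (-1 : ℝ) 1, (2 * Real.pi * complexForm a b x ^ n) *
          (g t * (((legendreP n).eval t : ℝ) : ℂ)) := by
        refine setIntegral_congr_fun measurableSet_Ioo fun t ht => ?_
        rw [integral_const_mul, integral_complexForm_pow_spherePoint n _ _ (by simpa using hab)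
          (by simpa using h0) ht, hx]
        ring
    _ = _ := by
        rw [integral_const_mul]
        ring

/-! ### Spherical harmonics as coefficients of isotropic powers -/

/-- The coefficient of `w ^ j` in `(ζ_w · y) ^ n`, where
`ζ_w = (i (1 + w²) / 2, (w² - 1) / 2, w)`. -/
def harmonicCoeff (n j : ℕ) (y : S2) : ℂ :=
  ((Polynomial.C (Complex.I / 2 * ((y : E3) 0 + Complex.I * (y : E3) 1)) +
    Polynomial.C ((y : E3) 2 : ℂ) * Polynomial.X +
    Polynomial.C (Complex.I / 2 * ((y : E3) 0 - Complex.I * (y : E3) 1)) *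
      Polynomial.X ^ 2) ^ n).coeff j

theorem sum_sq_eq_one (y : S2) : (y : E3) 0 ^ 2 + (y : E3) 1 ^ 2 + (y : E3) 2 ^ 2 = 1 := by
  have := norm_eq_of_mem_sphere y
  have h : ‖(y : E3)‖ ^ 2 = 1 := by rw [this]; norm_num
  rw [EuclideanSpace.real_norm_sq_eq, Fin.sum_univ_three] at h
  exact h

theorem harmonicCoeff_aux (y : S2) :
    Complex.I / 2 * ((y : E3) 0 - Complex.I * (y : E3) 1) *
      (Complex.I / 2 * ((y : E3) 0 + Complex.I * (y : E3) 1)) =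
      (((((y : E3) 2) ^ 2 - 1) / 4 : ℝ) : ℂ) := by
  have h : (((y : E3) 0 : ℝ) : ℂ) ^ 2 + (((y : E3) 1 : ℝ) : ℂ) ^ 2 + (((y : E3) 2 : ℝ) : ℂ) ^ 2 = 1 := by
    have := congrArg (fun r : ℝ => (r : ℂ)) (sum_sq_eq_one y)
    push_cast at this
    exact this
  push_cast
  linear_combination (-1 / 4) * h + (((y : E3) 0 : ℂ) ^ 2 / 4 +
    ((y : E3) 1 : ℂ) ^ 2 / 4 * (1 - Complex.I ^ 2)) * Complex.I_sq

theorem harmonicCoeff_add (n m : ℕ) (y : S2) :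
    harmonicCoeff n (n + m) y = (Complex.I / 2 * ((y : E3) 0 - Complex.I * (y : E3) 1)) ^ m *
      ((2 ^ m * n.factorial / (n + m).factorial *
        (Polynomial.derivative^[m] (legendreP n)).eval ((y : E3) 2) : ℝ) : ℂ) := by
  rw [harmonicCoeff, coeff_trinomial_pow_add, harmonicCoeff_aux, trinomialSum_ofReal,
    trinomialSum_eq_legendreP]

theorem harmonicCoeff_sub (n m : ℕ) (hmn : m ≤ n) (y : S2) :
    harmonicCoeff n (n - m) y = (Complex.I / 2 * ((y : E3) 0 + Complex.I * (y : E3) 1)) ^ m *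
      ((2 ^ m * n.factorial / (n + m).factorial *
        (Polynomial.derivative^[m] (legendreP n)).eval ((y : E3) 2) : ℝ) : ℂ) := by
  rw [harmonicCoeff, coeff_trinomial_pow_sub _ _ _ _ _ hmn, harmonicCoeff_aux, trinomialSum_ofReal,
    trinomialSum_eq_legendreP]

theorem continuous_harmonicCoeff (n j : ℕ) (hj : j < 2 * n + 1) :
    Continuous (harmonicCoeff n j) := by
  rcases le_total n j with h | h
  · obtain ⟨m, rfl⟩ := Nat.exists_eq_add_of_le h
    rw [funext (harmonicCoeff_add n m)]
    fun_prop
  · obtain ⟨m, rfl⟩ : ∃ m, j = n - m := ⟨n - j, by omega⟩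
    by_cases hm : m ≤ n
    · rw [funext (harmonicCoeff_sub n m hm)]
      fun_prop
    · rw [show n - m = n - n by omega, funext (harmonicCoeff_sub n n le_rfl)]
      fun_prop

/-- This trades the discontinuous longitude for a polynomial in the coordinates. At the poles both
sides vanish, so the value of `arg 0` is immaterial. -/
theorem arg_spherePolar (y : S2) :
    (Real.sqrt (1 - (y : E3) 2 ^ 2) : ℂ) *
      Complex.exp (Complex.arg (⟨(y : E3) 0, (y : E3) 1⟩ : ℂ) * Complex.I) =
      (y : E3) 0 + Complex.I * (y : E3) 1 := by
  have h : Real.sqrt (1 - (y : E3) 2 ^ 2) = ‖(⟨(y : E3) 0, (y : E3) 1⟩ : ℂ)‖ := by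
    rw [Complex.norm_eq_sqrt_sq_add_sq]
    congr 1
    linear_combination -sum_sq_eq_one y
  rw [h, Complex.norm_mul_exp_arg_mul_I]
  apply Complex.ext <;> simp

theorem arg_spherePolar_conj (y : S2) :
    (Real.sqrt (1 - (y : E3) 2 ^ 2) : ℂ) *
      Complex.exp (-(Complex.arg (⟨(y : E3) 0, (y : E3) 1⟩ : ℂ) * Complex.I)) =
      (y : E3) 0 - Complex.I * (y : E3) 1 := by
  have := congrArg (starRingEnd ℂ) (arg_spherePolar y)
  rw [map_mul, ← Complex.exp_conj] at this
  simpa [sub_eq_add_neg] using this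

theorem sphericalHarmonic_eq_harmonicCoeff (n : ℕ) (m : ℤ) (hm : |m| ≤ (n : ℤ)) :
    ∃ j < 2 * n + 1, ∃ c : ℂ, ∀ y, sphericalHarmonic n m y = c * harmonicCoeff n j y := by
  have hI : (Complex.I / 2 * 2 : ℂ) ≠ 0 := by simp
  have hn : (n.factorial : ℂ) ≠ 0 := by exact_mod_cast n.factorial_ne_zero
  -- `e^{ilφ}` comes with `(y₀ + i y₁)^l`, found `l` places below the middle coefficient; `e^{-ilφ}`
  -- comes with the conjugate, `l` places above.
  obtain ⟨l, rfl | rfl⟩ := m.eq_nat_or_neg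
  · have hl : l ≤ n := by simpa using hm
    have hnl : ((n + l).factorial : ℂ) ≠ 0 := by exact_mod_cast (n + l).factorial_ne_zero
    refine ⟨n - l, by omega, (Real.sqrt ((2 * n + 1) / (4 * Real.pi) *
      (((n - l).factorial : ℝ) / ((n + l).factorial : ℝ))) : ℂ) *
      ((n + l).factorial / n.factorial) / (Complex.I / 2 * 2) ^ l, fun y => ?_⟩
    have he : Complex.exp (Complex.I * ((l : ℤ) : ℂ) *
      (Complex.arg (⟨(y : E3) 0, (y : E3) 1⟩ : ℂ) : ℂ)) =
      Complex.exp (Complex.arg (⟨(y : E3) 0, (y : E3) 1⟩ : ℂ) * Complex.I) ^ l := by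
      rw [← Complex.exp_nat_mul]; congr 1; push_cast; ring
    rw [harmonicCoeff_sub n l hl, ← arg_spherePolar, sphericalHarmonic, he, assocLegendre,
      Int.natAbs_natCast]
    push_cast
    rw [mul_pow (Complex.I / 2), mul_pow (Complex.I / 2), mul_pow _ (Complex.exp _)]
    have hI' : (Complex.I / 2 : ℂ) ^ l ≠ 0 := pow_ne_zero _ (by simp)
    field_simp
  · have hl : l ≤ n := by simpa using hm
    have hnl : ((n + l).factorial : ℂ) ≠ 0 := by exact_mod_cast (n + l).factorial_ne_zero
    refine ⟨n + l, by omega, (Real.sqrt ((2 * n + 1) / (4 * Real.pi) *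
      (((n - l).factorial : ℝ) / ((n + l).factorial : ℝ))) : ℂ) *
      ((n + l).factorial / n.factorial) / (Complex.I / 2 * 2) ^ l, fun y => ?_⟩
    have he : Complex.exp (Complex.I * ((-(l : ℤ) : ℤ) : ℂ) *
      (Complex.arg (⟨(y : E3) 0, (y : E3) 1⟩ : ℂ) : ℂ)) =
      Complex.exp (-(Complex.arg (⟨(y : E3) 0, (y : E3) 1⟩ : ℂ) * Complex.I)) ^ l := by
      rw [← Complex.exp_nat_mul]; congr 1; push_cast; ring
    rw [harmonicCoeff_add n l, ← arg_spherePolar_conj, sphericalHarmonic, he, assocLegendre,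
      Int.natAbs_neg, Int.natAbs_natCast]
    push_cast
    rw [mul_pow (Complex.I / 2), mul_pow (Complex.I / 2), mul_pow _ (Complex.exp _)]
    have hI' : (Complex.I / 2 : ℂ) ^ l ≠ 0 := pow_ne_zero _ (by simp)
    field_simp

theorem continuous_sphericalHarmonic (n : ℕ) (m : ℤ) (hm : |m| ≤ (n : ℤ)) :
    Continuous (sphericalHarmonic n m) := by
  obtain ⟨j, hj, c, h⟩ := sphericalHarmonic_eq_harmonicCoeff n m hm
  rw [funext h]
  exact continuous_const.mul (continuous_harmonicCoeff n j hj)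

theorem complexForm_pow_eq_sum (n : ℕ) (w : ℝ) (y : S2) :
    complexForm !₂[0, (w ^ 2 - 1) / 2, w] !₂[(1 + w ^ 2) / 2, 0, 0] y ^ n =
      ∑ j ∈ Finset.range (2 * n + 1), harmonicCoeff n j y * (w : ℂ) ^ j := by
  simp only [harmonicCoeff]
  rw [← Polynomial.eval_eq_sum_range']
  · simp only [Polynomial.eval_pow, Polynomial.eval_add, Polynomial.eval_mul, Polynomial.eval_C,
      Polynomial.eval_X]
    congr 1
    simp only [complexForm, PiLp.inner_apply, Fin.sum_univ_three]
    simp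
    linear_combination (((y : E3) 1 : ℂ) * ((w : ℂ) ^ 2 - 1) / 2) * Complex.I_sq
  · refine Nat.lt_succ_of_le (Polynomial.natDegree_pow_le.trans ?_)
    rw [mul_comm]
    refine Nat.mul_le_mul_right _ ?_
    compute_degree

/-- Funk–Hecke for `(ζ_w · y)^n` is a polynomial identity in `w` valid for every real `w`, so it
holds coefficient by coefficient. -/
theorem funkHecke_harmonicCoeff (g : ℝ → ℂ) (hgm : Measurable g) (hg : IntegrableOn g (Ioo (-1) 1))
    (n j : ℕ) (hj : j < 2 * n + 1) (x : S2) :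
    ∫ y : S2, g (inner ℝ (x : E3) (y : E3)) * harmonicCoeff n j y ∂surface =
      2 * Real.pi * (∫ t in Ioo (-1 : ℝ) 1, g t * (((legendreP n).eval t : ℝ) : ℂ)) *
        harmonicCoeff n j x := by
  set l := 2 * Real.pi * (∫ t in Ioo (-1 : ℝ) 1, g t * (((legendreP n).eval t : ℝ) : ℂ)) with hl
  set p : Polynomial ℂ := ∑ j ∈ Finset.range (2 * n + 1), Polynomial.C
    (∫ y : S2, g (inner ℝ (x : E3) (y : E3)) * harmonicCoeff n j y ∂surface -
      l * harmonicCoeff n j x) * Polynomial.X ^ j with hp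
  have hroot (w : ℝ) : p.IsRoot (w : ℂ) := by
    have hF := funkHecke_complexForm g hgm hg n !₂[0, (w ^ 2 - 1) / 2, w] !₂[(1 + w ^ 2) / 2, 0, 0]
      (by
        rw [EuclideanSpace.norm_eq, EuclideanSpace.norm_eq]
        congr 1
        simp [Fin.sum_univ_three]
        ring) (by simp [PiLp.inner_apply, Fin.sum_univ_three]) x
    simp only [complexForm_pow_eq_sum, Finset.mul_sum] at hF
    rw [integral_finsetSum] at hF
    · rw [Polynomial.IsRoot, hp, Polynomial.eval_finsetSum]
      simp only [Polynomial.eval_mul, Polynomial.eval_C, Polynomial.eval_pow, Polynomial.eval_X,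
        sub_mul]
      rw [Finset.sum_sub_distrib, sub_eq_zero]
      simp only [← mul_assoc] at hF
      simp only [integral_mul_const] at hF
      exact hF
    · intro i hi
      exact integrable_zonal_mul g hgm hg x _
        ((continuous_harmonicCoeff n i (Finset.mem_range.1 hi)).mul continuous_const)
  have hp0 : p = 0 := by
    refine Polynomial.eq_zero_of_infinite_isRoot p ?_
    exact (infinite_range_of_injective Complex.ofReal_injective).mono
      (by rintro _ ⟨w, rfl⟩; exact hroot w)
  have hc := congrArg (fun q => Polynomial.coeff q j) hp0
  simp only [hp, Polynomial.finsetSum_coeff, Polynomial.coeff_C_mul_X_pow, Polynomial.coeff_zero] at hc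
  rw [Finset.sum_ite_eq, if_pos (Finset.mem_range.2 hj)] at hc
  exact sub_eq_zero.1 hc

/-- The Funk–Hecke formula for spherical harmonics. -/
theorem funkHecke_sphericalHarmonic (g : ℝ → ℂ) (hgm : Measurable g)
    (hg : IntegrableOn g (Ioo (-1) 1)) (n : ℕ) (m : ℤ) (hm : |m| ≤ (n : ℤ)) (x : S2) :
    ∫ y : S2, g (inner ℝ (x : E3) (y : E3)) * sphericalHarmonic n m y ∂surface =
      2 * Real.pi * (∫ t in Ioo (-1 : ℝ) 1, g t * (((legendreP n).eval t : ℝ) : ℂ)) *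
        sphericalHarmonic n m x := by
  obtain ⟨j, hj, c, h⟩ := sphericalHarmonic_eq_harmonicCoeff n m hm
  simp only [h, mul_left_comm _ c]
  rw [integral_const_mul, funkHecke_harmonicCoeff g hgm hg n j hj]

/-! ### Principal values of integrable functions -/

instance : IsFiniteMeasure surface := by unfold surface; infer_instance

theorem ae_ne (x : S2) : ∀ᵐ y ∂surface, y ≠ x := by
  have hm : Measurable (indicator ({1} : Set ℝ) (fun _ => (1 : ℂ))) :=
    measurable_const.indicator (measurableSet_singleton _)
  have h0 : ∀ t ∈ Ioo (-1 : ℝ) 1, indicator ({1} : Set ℝ) (fun _ => (1 : ℂ)) t = 0 :=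
    fun t ht => indicator_of_notMem (show t ∉ ({1} : Set ℝ) from ht.2.ne) _
  have hi : IntegrableOn (indicator ({1} : Set ℝ) (fun _ => (1 : ℂ))) (Ioo (-1) 1) :=
    integrableOn_zero.congr_fun (fun t ht => (h0 t ht).symm) measurableSet_Ioo
  -- With `n = 0` and the zero form, `0 ^ 0 = 1`, so Funk–Hecke computes the measure of `{x · y =
  -- 1}` as an integral over `(-1, 1)` of the indicator of `{1}`, which vanishes there.
  have h := funkHecke_complexForm _ hm hi 0 0 0 rfl (by simp) x
  have hz : ∫ t in Ioo (-1 : ℝ) 1, indicator ({1} : Set ℝ) (fun _ => (1 : ℂ)) t *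
      (((legendreP 0).eval t : ℝ) : ℂ) = 0 :=
    setIntegral_eq_zero_of_forall_eq_zero fun t ht => by rw [h0 t ht, zero_mul]
  rw [hz] at h
  have hs : MeasurableSet {y : S2 | inner ℝ (x : E3) (y : E3) = 1} :=
    (by fun_prop : Measurable fun y : S2 => inner ℝ (x : E3) (y : E3)) (measurableSet_singleton 1)
  have e : (fun y : S2 => indicator ({1} : Set ℝ) (fun _ => (1 : ℂ)) (inner ℝ (x : E3) (y : E3)) *
      complexForm 0 0 y ^ 0) = indicator {y : S2 | inner ℝ (x : E3) (y : E3) = 1} (fun _ => 1) := by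
    ext y
    simp [indicator]
  rw [e, integral_indicator_const _ hs, mul_zero, zero_mul] at h
  have h' : surface {y : S2 | inner ℝ (x : E3) (y : E3) = 1} = 0 := by
    simpa [measureReal_eq_zero_iff] using h
  refine measure_mono_null (fun y hy => ?_) h'
  have : y = x := by simpa using hy
  simp [this]

theorem tendsto_truncatedIntegral (f : S2 → ℂ) (x : S2) (hf : Integrable f surface) :
    Tendsto (truncatedIntegral f x) (𝓝[>] 0) (𝓝 (∫ y, f y ∂surface)) := by
  have hs (ε : ℝ) : MeasurableSet {y : S2 | ε < dist x y} :=
    (isOpen_lt continuous_const (by fun_prop)).measurableSet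
  have : truncatedIntegral f x = fun ε => ∫ y, {y : S2 | ε < dist x y}.indicator f y ∂surface := by
    ext ε
    rw [truncatedIntegral, integral_indicator (hs ε)]
  rw [this]
  refine tendsto_integral_filter_of_dominated_convergence (fun y => ‖f y‖)
    (Eventually.of_forall fun ε => hf.aestronglyMeasurable.indicator (hs ε))
    (Eventually.of_forall fun ε => ae_of_all _ fun y => norm_indicator_le_norm_self f y) hf.norm ?_
  filter_upwards [ae_ne x] with y hy
  refine tendsto_const_nhds.congr' ?_
  filter_upwards [nhdsWithin_le_nhds (Iio_mem_nhds (dist_pos.2 hy.symm))] with ε hε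
  rw [indicator_of_mem (show y ∈ {y : S2 | ε < dist x y} from hε)]

theorem pvExists_of_integrable (f : S2 → ℂ) (x : S2) (hf : Integrable f surface) : PVExists f x :=
  ⟨fun _ _ => hf.integrableOn, _, tendsto_truncatedIntegral f x hf⟩

theorem pvIntegral_of_integrable (f : S2 → ℂ) (x : S2) (hf : Integrable f surface) :
    pvIntegral f x = ∫ y, f y ∂surface :=
  (tendsto_truncatedIntegral f x hf).limUnder_eq

/-! ### The zonal kernel and its eigenvalues -/

/-- The wave `e^{ikr}`, as a function of the cosine `t` of the angle between two points of the
sphere at distance `r`. -/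
def zonalWave (k t : ℝ) : ℂ := Complex.exp (Complex.I * k * (Real.sqrt (2 * (1 - t)) : ℂ))

theorem normalDerivGreen_eq (k : ℝ) (x y : S2) (hxy : y ≠ x) :
    normalDerivGreen k x y = 1 / (8 * Real.pi) *
      (zonalWave k (inner ℝ (x : E3) (y : E3)) / Real.sqrt (2 * (1 - inner ℝ (x : E3) (y : E3))) -
        Complex.I * k * zonalWave k (inner ℝ (x : E3) (y : E3))) := by
  have hx1 : inner ℝ (x : E3) (x : E3) = 1 := by
    rw [real_inner_self_eq_norm_sq, norm_eq_of_mem_sphere]; norm_num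
  have hy1 : inner ℝ (y : E3) (y : E3) = 1 := by
    rw [real_inner_self_eq_norm_sq, norm_eq_of_mem_sphere]; norm_num
  set r := ‖(x : E3) - y‖ with hr
  have hr0 : 0 < r := norm_pos_iff.2 (sub_ne_zero.2 fun h => hxy (Subtype.ext h.symm))
  have hr2 : r ^ 2 = 2 * (1 - inner ℝ (x : E3) (y : E3)) := by
    rw [hr, ← real_inner_self_eq_norm_sq, inner_sub_left, inner_sub_right, inner_sub_right, hx1, hy1,
      real_inner_comm (y : E3) (x : E3)]
    ring
  have hsq : Real.sqrt (2 * (1 - inner ℝ (x : E3) (y : E3))) = r := by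
    rw [← hr2, Real.sqrt_sq hr0.le]
  have hρ : HasFDerivAt (fun z : E3 => ‖z - (y : E3)‖)
      ((1 / (2 * r)) • (2 • (innerSL ℝ ((x : E3) - y)).comp (ContinuousLinearMap.id ℝ E3))) (x : E3) := by
    have h := ((hasFDerivAt_id (x : E3)).sub_const (y : E3)).norm_sq.sqrt (pow_pos hr0 2).ne'
    simpa [Real.sqrt_sq (norm_nonneg _)] using h
  have hφ : HasDerivAt (fun s : ℝ => -(Complex.exp (Complex.I * k * s) / (4 * Real.pi * s)))
      (-((Complex.exp (Complex.I * k * r) * (Complex.I * k) * (4 * Real.pi * r) -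
        Complex.exp (Complex.I * k * r) * (4 * Real.pi)) / (4 * Real.pi * r) ^ 2)) r := by
    have hid : HasDerivAt (fun s : ℝ => (s : ℂ)) 1 r := Complex.ofRealCLM.hasDerivAt
    have h1 := (hid.const_mul (Complex.I * k)).cexp
    have h2 := hid.const_mul (4 * (Real.pi : ℂ))
    have h3 := (h1.div h2 (by
      have h4 : (Real.pi : ℂ) ≠ 0 := by exact_mod_cast Real.pi_ne_zero
      have h5 : (r : ℂ) ≠ 0 := by exact_mod_cast hr0.ne'
      simp [h4, h5])).neg
    simp only [mul_one] at h3
    exact h3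
  have hcomp := hφ.hasFDerivAt.comp (x : E3) hρ
  have hG : (fun z : E3 => greenFn k (z - (y : E3))) =
      (fun s : ℝ => -(Complex.exp (Complex.I * k * s) / (4 * Real.pi * s))) ∘
        fun z : E3 => ‖z - (y : E3)‖ := rfl
  -- Hence `(x - y) · x = r²/2`, so the derivative of `r` in the direction `x` is `r/2`; this lowers
  -- the `1/r²` singularity to `1/r`.
  have hyx : inner ℝ (y : E3) (x : E3) = 1 - r ^ 2 / 2 := by
    rw [hr2, real_inner_comm]; ring
  rw [normalDerivGreen, hG, hcomp.fderiv, zonalWave, hsq]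
  have hπ : (Real.pi : ℂ) ≠ 0 := by exact_mod_cast Real.pi_ne_zero
  have hrc : (r : ℂ) ≠ 0 := by exact_mod_cast hr0.ne'
  simp [hyx]
  field_simp
  ring

theorem image_one_sub_sq_div_two : (fun s : ℝ => 1 - s ^ 2 / 2) '' Ioo 0 2 = Ioo (-1) 1 := by
  ext t
  constructor
  · rintro ⟨s, hs, rfl⟩
    constructor <;> simp only <;> nlinarith [hs.1, hs.2]
  · intro ht
    have h : 0 < 2 * (1 - t) := by linarith [ht.2]
    refine ⟨Real.sqrt (2 * (1 - t)), ⟨Real.sqrt_pos.2 h, ?_⟩, ?_⟩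
    · rw [Real.sqrt_lt' two_pos]; linarith [ht.1]
    · simp only [Real.sq_sqrt h.le]; ring

theorem hasDerivWithinAt_one_sub_sq_div_two (s : ℝ) (S : Set ℝ) :
    HasDerivWithinAt (fun s : ℝ => 1 - s ^ 2 / 2) (-s) S s := by
  have h := (((hasDerivAt_pow 2 s).div_const 2).const_sub 1).hasDerivWithinAt (s := S)
  simpa using h

theorem injOn_one_sub_sq_div_two : InjOn (fun s : ℝ => 1 - s ^ 2 / 2) (Ioo 0 2) := by
  intro a ha b hb h
  have h' : a ^ 2 = b ^ 2 := by simp only at h; linarith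
  exact (pow_left_inj₀ ha.1.le hb.1.le two_ne_zero).1 h'

/-- Here `s` is the chord length `√(2(1 - t))`; the Jacobian `s` of `t = 1 - s²/2` cancels the
denominator. -/
theorem substitution_zonalWave_div (k : ℝ) (P : ℝ → ℂ) {s : ℝ} (hs : s ∈ Ioo (0 : ℝ) 2) :
    |(-s)| • (zonalWave k (1 - s ^ 2 / 2) / Real.sqrt (2 * (1 - (1 - s ^ 2 / 2))) *
      P (1 - s ^ 2 / 2)) = Complex.exp (Complex.I * k * s) * P (1 - s ^ 2 / 2) := by
  have h : Real.sqrt (2 * (1 - (1 - s ^ 2 / 2))) = s := by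
    rw [show 2 * (1 - (1 - s ^ 2 / 2)) = s ^ 2 by ring, Real.sqrt_sq hs.1.le]
  have hsc : (s : ℂ) ≠ 0 := by exact_mod_cast hs.1.ne'
  rw [zonalWave, h, abs_neg, abs_of_pos hs.1, Complex.real_smul]
  field_simp

theorem integrableOn_zonalWave_div_mul (k : ℝ) (P : ℝ → ℂ) (hP : Continuous P) :
    IntegrableOn (fun t => zonalWave k t / Real.sqrt (2 * (1 - t)) * P t) (Ioo (-1) 1) := by
  rw [← image_one_sub_sq_div_two, integrableOn_image_iff_integrableOn_abs_deriv_smul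
    measurableSet_Ioo (fun s _ => hasDerivWithinAt_one_sub_sq_div_two s _)
    injOn_one_sub_sq_div_two]
  have h : IntegrableOn (fun s : ℝ => Complex.exp (Complex.I * k * s) * P (1 - s ^ 2 / 2))
      (Ioo 0 2) :=
    ((by fun_prop : Continuous _).integrableOn_Icc (a := (0 : ℝ)) (b := 2)).mono_set
      Ioo_subset_Icc_self
  exact h.congr_fun (fun s hs => (substitution_zonalWave_div k P hs).symm) measurableSet_Ioo

theorem integral_zonalWave_div_mul (k : ℝ) (P : ℝ → ℂ) :
    ∫ t in Ioo (-1 : ℝ) 1, zonalWave k t / Real.sqrt (2 * (1 - t)) * P t =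
      ∫ s in (0 : ℝ)..2, Complex.exp (Complex.I * k * s) * P (1 - s ^ 2 / 2) := by
  rw [← image_one_sub_sq_div_two, integral_image_eq_integral_abs_deriv_smul
    measurableSet_Ioo (fun s _ => hasDerivWithinAt_one_sub_sq_div_two s _)
    injOn_one_sub_sq_div_two, intervalIntegral.integral_of_le zero_le_two,
    integral_Ioc_eq_integral_Ioo]
  exact setIntegral_congr_fun measurableSet_Ioo fun s hs => substitution_zonalWave_div k P hs

theorem continuous_zonalWave (k : ℝ) : Continuous (zonalWave k) := by
  unfold zonalWave
  fun_prop

/-- The kernel of the Neumann–Poincaré operator as a function of `t = x · y`. -/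
def zonalKernel (k t : ℝ) : ℂ :=
  1 / (8 * Real.pi) * (zonalWave k t / Real.sqrt (2 * (1 - t)) - Complex.I * k * zonalWave k t)

theorem measurable_zonalKernel (k : ℝ) : Measurable (zonalKernel k) := by
  have h := (continuous_zonalWave k).measurable
  unfold zonalKernel
  fun_prop

theorem integrableOn_zonalWave_mul (k : ℝ) (P : ℝ → ℂ) (hP : Continuous P) :
    IntegrableOn (fun t => zonalWave k t * P t) (Ioo (-1) 1) :=
  (((continuous_zonalWave k).mul hP).integrableOn_Icc).mono_set Ioo_subset_Icc_self

theorem integrableOn_zonalKernel (k : ℝ) : IntegrableOn (zonalKernel k) (Ioo (-1) 1) := by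
  have h1 := integrableOn_zonalWave_div_mul k (fun _ => 1) continuous_const
  have h2 := integrableOn_zonalWave_mul k (fun _ => 1) continuous_const
  simp only [mul_one] at h1 h2
  exact (h1.sub (h2.const_mul (Complex.I * k))).const_mul _

theorem integral_zonalKernel_mul_legendreP (n : ℕ) (k : ℝ) (hk : k ≠ 0) :
    2 * Real.pi * ∫ t in Ioo (-1 : ℝ) 1, zonalKernel k t * (((legendreP n).eval t : ℝ) : ℂ) =
      Complex.I * k / 2 * (sphericalJ n k * sphericalH1 n k + cCoeff n k) := by
  have hP : Continuous fun t : ℝ => (((legendreP n).eval t : ℝ) : ℂ) := by fun_prop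
  have h1 := integrableOn_zonalWave_div_mul k _ hP
  have h2 := integrableOn_zonalWave_mul k _ hP
  have e : (fun t => zonalKernel k t * (((legendreP n).eval t : ℝ) : ℂ)) = fun t =>
      1 / (8 * (Real.pi : ℂ)) * (zonalWave k t / Real.sqrt (2 * (1 - t)) *
        (((legendreP n).eval t : ℝ) : ℂ) -
        Complex.I * k * (zonalWave k t * (((legendreP n).eval t : ℝ) : ℂ))) := by
    ext t
    rw [zonalKernel]
    ring
  have hc : cCoeff n k = -(1 / 2) *
      ∫ t in Ioo (-1 : ℝ) 1, zonalWave k t * (((legendreP n).eval t : ℝ) : ℂ) := by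
    rw [cCoeff, intervalIntegral.integral_of_le (by norm_num), integral_Ioc_eq_integral_Ioo]
    rfl
  have hπ : (Real.pi : ℂ) ≠ 0 := by exact_mod_cast Real.pi_ne_zero
  rw [e, integral_const_mul, integral_sub h1 (h2.const_mul _), integral_const_mul,
    integral_zonalWave_div_mul k (fun t => (((legendreP n).eval t : ℝ) : ℂ)),
    integral_exp_mul_legendreP n k hk, hc]
  field_simp
  ring

/-- The formula for the kernel is available off `y = x`, and a single point is null. -/
theorem ae_normalDerivGreen_eq (k : ℝ) (x : S2) (ψ : S2 → ℂ) :
    (fun y : S2 => zonalKernel k (inner ℝ (x : E3) (y : E3)) * ψ y) =ᵐ[surface]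
      fun y => normalDerivGreen k x y * ψ y := by
  filter_upwards [ae_ne x] with y hy
  rw [normalDerivGreen_eq k x y hy, zonalKernel]

end HelmholtzNP

end

theorem lemma2p5 (k : ℝ) (hk : 0 < k) (n : ℕ) (m : ℤ) (hm : |m| ≤ (n : ℤ)) :
    (∀ x : HelmholtzNP.S2, HelmholtzNP.PVExists
      (fun y => HelmholtzNP.normalDerivGreen k x y * HelmholtzNP.sphericalHarmonic n m y) x) ∧
    HelmholtzNP.neumannPoincare k (HelmholtzNP.sphericalHarmonic n m) =
      (Complex.I * (k : ℂ) / 2 *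
        ((HelmholtzNP.sphericalJ n k : ℂ) * HelmholtzNP.sphericalH1 n k +
          HelmholtzNP.cCoeff n k)) • HelmholtzNP.sphericalHarmonic n m := by
  have hint (x : HelmholtzNP.S2) := (HelmholtzNP.integrable_zonal_mul _
    (HelmholtzNP.measurable_zonalKernel k) (HelmholtzNP.integrableOn_zonalKernel k) x _
    (HelmholtzNP.continuous_sphericalHarmonic n m hm)).congr
      (HelmholtzNP.ae_normalDerivGreen_eq k x _)
  refine ⟨fun x => HelmholtzNP.pvExists_of_integrable _ x (hint x), funext fun x => ?_⟩
  rw [HelmholtzNP.neumannPoincare, HelmholtzNP.pvIntegral_of_integrable _ x (hint x),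
    ← integral_congr_ae (HelmholtzNP.ae_normalDerivGreen_eq k x _),
    HelmholtzNP.funkHecke_sphericalHarmonic _ (HelmholtzNP.measurable_zonalKernel k)
      (HelmholtzNP.integrableOn_zonalKernel k) n m hm,
    HelmholtzNP.integral_zonalKernel_mul_legendreP n k hk.ne', Pi.smul_apply, smul_eq_mul]
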